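/- Let $l\ge 4$, and let $A=(a_{pq})$ be the generalized Cartan matrix of type $D_l^{(1)}$ with vertices $0,1,\dots,l$: $a_{pp}=2$, and for $p\neq q$, $a_{pq}=-1$ if $p,q$ are joined by one of the edges $0-2$, $1-2-3-\cdots-(l-1)$, $(l-2)-l$, and $a_{pq}=0$ otherwise. Let $W$ be its Weyl group, i.e. the Coxeter group with generators $s_0,\dots,s_l$ in which $s_p^2=1$ and, for $p\ne q$, $s_ps_q=s_qs_p$ if $a_{pq}=0$ and $s_ps_qs_p=s_qs_ps_q$ if $a_{pq}=-1$. Let $W_0=\langle s_1,\dots,s_l\rangle$. The spin-type heap $E$ has one element $(p,k)$ labelled $p$ in layer $k\in\mathbb Z$ whenever: $k\equiv p \pmod 2$ for $2\le p\le l-2$; $k\equiv 1,\,3,\,l+3,\,l+1 \pmod 4$ for $p=0,\,1,\,l-1,\,l$ respectively. Its order is the reflexive transitive closure of the relation "$k<k'$ and $p,p'$ are equal or adjacent" between $(p,k)$ and $(p',k')$. A proper ideal is a down-closed $I\subset E$ that contains, for each label $p$, some but not all elements labelled $p$; $\mathcal B$ is the set of proper ideals. For $I\in\mathcal B$ define $S_p(I)\in\mathcal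 B$ by removing an element labelled $p$ from $I$ if this leaves a proper ideal, otherwise by adding an element labelled $p$ to $I$ if this gives a proper ideal, otherwise $S_p(I)=I$. Write $E(0,t)=(0,4t+1)$, let $h(I)=\max\{t: E(0,t)\in I\}$ be the height, and let $\phi$ be the automorphism $(p,k)\mapsto(p,k+4)$ of $E$. A string is an element of $\{+,-\}^l$; it is even if it has an even number of minus signs. To $F\in\mathcal B$ with $h(F)=0$ attach a string $\sigma(F)$ as follows. Put $G=F\setminus\{x: x\le E(0,0)\}$, and place $(p,k)$ at the point $(x,y)$ with $y=k-3$ and $x=p-1$ for $1\le p\le l-1$, $x=l-2$ for $p=l$. For $0\le i\le l-2$ let $g(i)=\max\{y:(i,y)\in G\}+1$, or $g(i)=-i-1$ if $G$ has no element in column $i$, and let $g(-1)=0$. For $1\le i\le l-1$ the $i$-th symbol of $\sigma(F)$ is $+$ if $g(i-1)>g(i-2)$ and $-$ if $g(i-1)<g(i-2)$; the $l$-th symbol is $+$ if $g(l-2)\equiv l-1\pmod 4$ and $-$ otherwise. For $I\in\mathcal B$ put $\mathrm{code}(I)=(h(I),\ \sigma(\phi^{-h(I)}(I)))$. Proposition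 8.2. $E$ is a full heap over the Dynkin diagram of $A$, and its covering relations raise the layer by exactly $1$. (Full heap means: intervals are finite; elements with equal or adjacent labels are comparable and the order is the transitive closure of its restriction to such pairs; the elements with any given label are unbounded above and below; if $p,q$ are adjacent, each element labelled $p$ covers or is covered by one labelled $q$; and for consecutive elements $\alpha<\beta$ labelled $p$ the sum of $a_{p,q}$ over the labels $q$ of the elements of the open interval $(\alpha,\beta)$ is $-2$.) The group $W_0$ is finite and is the Weyl group of type $D_l$, with $s_1,\dots,s_l$ as its Coxeter generators. The map $\mathrm{code}$ is a bijection from $\mathcal B$ onto $\mathbb Z\times\{\text{even strings}\}$, and $s_p\cdot I=S_p(I)$ defines an action of $W$ on $\mathcal B$. Moreover: (i) The elements of $W_0$ preserve height, and the action of $W$ on $\mathcal B$ induces via $\mathrm{code}$ a transitive and faithful action of $W_0$ on the set of even strings. For $1\le i<l$, $s_i$ exchanges the symbols at positions $i$ and $i+1$; $s_l$ exchanges the symbols at positions $l-1$ and $l$ and then alters both of them. (ii) The action of $W$ on $\mathbb Z\times\{\text{even strings}\}$ transported from $\mathcal B$ by $\mathrm{code}$ extends the action in (i) (each $w\in W_0$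 acts as $(\mathrm{id},w)$) and is faithful. It is the restriction of a faithful action of $W$ on $\mathbb Z\times\{+,-\}^l$, in which $s_i$ for $1\le i\le l$ acts as $(\mathrm{id},s_i)$, with $s_i$ given on all strings by the formulas in (i), and $s_0$ acts as follows, where $\mathbf s'$ denotes the string with its first two symbols deleted: $$s_0(t,{+}{+}\mathbf s')=(t+1,{-}{-}\mathbf s'),\quad s_0(t,{-}{-}\mathbf s')=(t-1,{+}{+}\mathbf s'),\quad s_0(t,{+}{-}\mathbf s')=(t,{+}{-}\mathbf s'),\quad s_0(t,{-}{+}\mathbf s')=(t,{-}{+}\mathbf s').$$ -/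

import Mathlib

open Relation

/-! ### Heaps over Dynkin diagrams

`A` is a generalized Cartan matrix indexed by the vertices `P` of its Dynkin diagram, and
`ε : E → P` labels a partially ordered set `E`.  Two vertices are equal or adjacent in the
diagram exactly when the entry of `A` at them is nonzero. -/

section Heaps

variable {P E : Type} [PartialOrder E]

/-- `(E, ≤, ε)` is a labelled heap: intervals are finite, elements with equal or adjacent labels
are comparable, and the order is the transitive closure of its restriction to pairs of elements
with equal or adjacent labels. -/
structure IsHeap (A : Matrix P P ℤ) (ε : E → P) : Prop where
  finite_Icc : ∀ a b : E, (Set.Icc a b).Finite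
  comparable : ∀ a b : E, A (ε a) (ε b) ≠ 0 → a ≤ b ∨ b ≤ a
  le_iff : ∀ a b : E, a ≤ b ↔ TransGen (fun x y => x ≤ y ∧ A (ε x) (ε y) ≠ 0) a b

/-- A fibred heap: every chain of elements with a given label is unbounded above and below, and
for adjacent vertices `p`, `q`, every element labelled `p` covers or is covered by an element
labelled `q`. -/
structure IsFibredHeap (A : Matrix P P ℤ) (ε : E → P) : Prop extends IsHeap A ε where
  not_bddAbove : ∀ p : P, ¬ BddAbove (ε ⁻¹' {p})
  not_bddBelow : ∀ p : P, ¬ BddBelow (ε ⁻¹' {p})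
  exists_cover : ∀ (p q : P), p ≠ q → A p q ≠ 0 → ∀ a : E, ε a = p →
    ∃ b : E, ε b = q ∧ (a ⋖ b ∨ b ⋖ a)

/-- A full heap: for consecutive elements `a < b` with the same label `p`, the sum of the entries
`A p (ε c)` over the open interval from `a` to `b` is `-2`. -/
structure IsFullHeap (A : Matrix P P ℤ) (ε : E → P) : Prop extends IsFibredHeap A ε where
  sum_Ioo : ∀ a b : E, a < b → ε a = ε b → (∀ c ∈ Set.Ioo a b, ε c ≠ ε a) →
    ∑ᶠ c ∈ Set.Ioo a b, A (ε a) (ε c) = -2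

/-- Proper ideals: down-closed subsets which meet the fibre of every label in a nonempty proper
subset of that fibre. -/
@[ext]
structure ProperIdeal (ε : E → P) where
  carrier : Set E
  lower : ∀ a ∈ carrier, ∀ b : E, b ≤ a → b ∈ carrier
  exists_mem : ∀ p : P, ∃ a, ε a = p ∧ a ∈ carrier
  exists_notMem : ∀ p : P, ∃ a, ε a = p ∧ a ∉ carrier

/-- `J` is obtained from `I` by removing one element labelled `p`. -/
def ProperIdeal.Removes {ε : E → P} (p : P) (I J : ProperIdeal ε) : Prop :=
  ∃ a ∈ I.carrier, ε a = p ∧ J.carrier = I.carrier \ {a}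

/-- `J` is obtained from `I` by adding one element labelled `p`. -/
def ProperIdeal.Adds {ε : E → P} (p : P) (I J : ProperIdeal ε) : Prop :=
  ∃ a ∉ I.carrier, ε a = p ∧ J.carrier = I.carrier ∪ {a}

open Classical in
/-- The operator `S_p` on proper ideals: remove an element labelled `p` if this leaves a proper
ideal; otherwise add an element labelled `p` if this gives a proper ideal; otherwise do nothing.
(In a heap there is at most one such element in each case.) -/
noncomputable def ProperIdeal.reflect {ε : E → P} (p : P) (I : ProperIdeal ε) : ProperIdeal ε :=
  if h : ∃ J, I.Removes p J then h.choose
  else if h : ∃ J, I.Adds p J then h.choose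
  else I

end Heaps

/-! ### Weyl groups -/

/-- The Coxeter matrix attached to a generalized Cartan matrix `A`: off the diagonal its entry is
`2, 3, 4, 6` or `∞` (written `0`) according as `A i j * A j i` is `0, 1, 2, 3` or anything else.
The Weyl group of `A` is the Coxeter group of this matrix. -/
def weylCoxeterMatrix {P : Type} [DecidableEq P] (A : Matrix P P ℤ) : CoxeterMatrix P where
  M := Matrix.of fun i j =>
    if i = j then 1
    else if A i j * A j i = 0 then 2
    else if A i j * A j i = 1 then 3
    else if A i j * A j i = 2 then 4
    else if A i j * A j i = 3 then 6
    else 0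
  isSymm := by
    ext i j
    simp only [Matrix.transpose_apply, Matrix.of_apply, mul_comm (A j i) (A i j),
      eq_comm (a := j) (b := i)]
  diagonal := by simp
  off_diagonal := by
    intro i j hij
    simp only [Matrix.of_apply, if_neg hij]
    split_ifs <;> norm_num

/-- The Weyl group of a generalized Cartan matrix. -/
abbrev WeylGroup {P : Type} [DecidableEq P] (A : Matrix P P ℤ) : Type :=
  (weylCoxeterMatrix A).Group

/-- The Coxeter generators of the Weyl group. -/
abbrev weylSimple {P : Type} [DecidableEq P] (A : Matrix P P ℤ) (p : P) : WeylGroup A :=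
  (weylCoxeterMatrix A).simple p

/-! ### Type `D_l^{(1)}` -/

/-- The edges `0—2`, `1—2—⋯—(l-2)—(l-1)` and `(l-2)—l` of the Dynkin diagram of type `D_l^{(1)}`,
each listed with its smaller end first. -/
def affineDEdge (l i j : ℕ) : Prop :=
  (i = 0 ∧ j = 2) ∨ (1 ≤ i ∧ j = i + 1 ∧ j < l) ∨ (i + 2 = l ∧ j = l)

instance (l i j : ℕ) : Decidable (affineDEdge l i j) := by
  unfold affineDEdge; infer_instance

/-- The generalized Cartan matrix of type `D_l^{(1)}`, with vertices `0, 1, …, l`. -/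
def affineDMatrix (l : ℕ) : Matrix (Fin (l + 1)) (Fin (l + 1)) ℤ :=
  Matrix.of fun i j =>
    if i = j then 2
    else if affineDEdge l i j ∨ affineDEdge l j i then -1
    else 0

/-- The finite parabolic subgroup `W₀` generated by the `s_p` with `p ≠ 0`. -/
def finiteWeylSubgroup (l : ℕ) : Subgroup (WeylGroup (affineDMatrix l)) :=
  Subgroup.closure (weylSimple (affineDMatrix l) '' {p | p ≠ 0})

/-- The generator `s_{i+1}` as an element of `W₀`, where `i = 0, …, l - 1`. -/
def finiteSimple (l : ℕ) (i : Fin l) : finiteWeylSubgroup l :=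
  ⟨weylSimple (affineDMatrix l) i.succ,
    Subgroup.subset_closure ⟨i.succ, Fin.succ_ne_zero i, rfl⟩⟩

/-! ### The spin-type heap -/

/-- The label `p` occurs in the `k`-th layer of the heap. -/
def OccursInLayer (l p : ℕ) (k : ℤ) : Prop :=
  if p = 0 then k ≡ 1 [ZMOD 4]
  else if p = 1 then k ≡ 3 [ZMOD 4]
  else if p + 1 = l then k ≡ l + 3 [ZMOD 4]
  else if p = l then k ≡ l + 1 [ZMOD 4]
  else k ≡ p [ZMOD 2]

/-- The elements of the heap: one element labelled `p` in each layer in which `p` occurs. -/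
@[ext]
structure SpinHeap (l : ℕ) where
  label : Fin (l + 1)
  rank : ℤ
  occurs : OccursInLayer l label rank

namespace SpinHeap

variable {l : ℕ}

/-- `a` lies in a lower layer than `b`, and their labels are equal or adjacent. -/
def Below (a b : SpinHeap l) : Prop :=
  a.rank < b.rank ∧ affineDMatrix l a.label b.label ≠ 0

theorem rank_le_of_reflTransGen {a b : SpinHeap l} (h : ReflTransGen Below a b) :
    a = b ∨ a.rank < b.rank := by
  induction h with
  | refl => exact Or.inl rfl
  | tail _ h ih =>
    rcases ih with rfl | ih
    · exact Or.inr h.1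
    · exact Or.inr (ih.trans h.1)

/-- The heap order is the reflexive transitive closure of `Below`. -/
instance : PartialOrder (SpinHeap l) where
  le := ReflTransGen Below
  le_refl _ := ReflTransGen.refl
  le_trans _ _ _ := ReflTransGen.trans
  le_antisymm a b hab hba := by
    rcases rank_le_of_reflTransGen hab with h | h
    · exact h
    · rcases rank_le_of_reflTransGen hba with h' | h'
      · exact h'.symm
      · exact absurd (h.trans h') (lt_irrefl _)

theorem occursInLayer_add_four_mul {l p : ℕ} {k : ℤ} (n : ℤ) (h : OccursInLayer l p k) :
    OccursInLayer l p (k + 4 * n) := by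
  unfold OccursInLayer at *
  split_ifs at * <;> simp only [Int.ModEq] at * <;> omega

/-- Translation by `4 * n` layers, which preserves labels. -/
def translate (n : ℤ) (a : SpinHeap l) : SpinHeap l :=
  ⟨a.label, a.rank + 4 * n, occursInLayer_add_four_mul n a.occurs⟩

theorem translate_mono (n : ℤ) {a b : SpinHeap l} (h : a ≤ b) : translate n a ≤ translate n b := by
  have h' : ReflTransGen Below a b := h
  have key : ReflTransGen Below (translate n a) (translate n b) := by
    induction h' with
    | refl => exact ReflTransGen.refl
    | tail _ hbc ih =>
      exact (ih ‹_›).tail ⟨by simpa [translate] using hbc.1, hbc.2⟩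
  exact key

theorem translate_translate (m n : ℤ) (h : m + n = 0) (a : SpinHeap l) :
    translate m (translate n a) = a := by
  ext
  · rfl
  · simp only [translate]; omega

/-- The fundamental automorphism `φ` of the periodic heap: it moves every element to the element
with the same label four layers above. -/
def phi (l : ℕ) : SpinHeap l ≃o SpinHeap l where
  toFun := translate 1
  invFun := translate (-1)
  left_inv := translate_translate _ _ (by norm_num)
  right_inv := translate_translate _ _ (by norm_num)
  map_rel_iff' := by
    intro a b
    refine ⟨fun h => ?_, translate_mono 1⟩
    have := translate_mono (-1) h
    simpa [translate_translate] using this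

/-- The element `E(0, t)`: the `t`-th element labelled `0`, where `E(0, 0)` lies in layer `1`. -/
def zeroElt (l : ℕ) (t : ℤ) : SpinHeap l :=
  ⟨0, 4 * t + 1, by simp [OccursInLayer, Int.ModEq]⟩

/-- The lattice `ℬ` of proper ideals of the heap. -/
abbrev Ideals (l : ℕ) : Type := ProperIdeal (SpinHeap.label (l := l))

/-- The height of a set of elements: the maximal `t` such that `E(0, t)` belongs to it. -/
noncomputable def height (F : Set (SpinHeap l)) : ℤ := sSup {t | zeroElt l t ∈ F}

/-! The grid.  Elements labelled `p` with `1 ≤ p ≤ l - 1` stand in column `p - 1`, those labelled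
`0` in column `0`, and those labelled `l` in column `l - 2`.  The vertical coordinate is normalised
so that the only element labelled `1` which is neither `≤ E(0, 0)` nor `≥ E(0, 1)` is at
`(0, 0)`. -/

/-- Horizontal coordinate. -/
def column (a : SpinHeap l) : ℕ :=
  if (a.label : ℕ) = l then l - 2 else (a.label : ℕ) - 1

/-- Vertical coordinate. -/
def row (a : SpinHeap l) : ℤ := a.rank - 3

open Classical in
/-- `g(G, i)`: one more than the largest `y` such that the position `(i, y)` belongs to `G`, or
`-i - 1` if `G` has no element in column `i`. -/
noncomputable def gFun (G : Set (SpinHeap l)) (i : ℕ) : ℤ :=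
  if ∃ a ∈ G, a.column = i then sSup {y | ∃ a ∈ G, a.column = i ∧ a.row = y} + 1
  else -(i : ℤ) - 1

/-- The binary path `f : {-1, 0, …, l - 2} → ℤ` of `G`, with the argument shifted by one:
`binaryPath G i = f(i - 1)`, where `f(-1) = 0` and `f(j) = g(G, j)` for `j ≥ 0`. -/
noncomputable def binaryPath (G : Set (SpinHeap l)) : ℕ → ℤ
  | 0 => 0
  | i + 1 => gFun G i

end SpinHeap

/-! ### Strings -/

/-- Strings of length `l` in the symbols `+` (that is, `1`) and `-` (that is, `-1`).
The `i`-th letter of a string, for `1 ≤ i ≤ l`, is its value at `i - 1 : Fin l`. -/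
abbrev SignString (l : ℕ) : Type := Fin l → ℤˣ

/-- The string contains an even number of minus signs. -/
def EvenMinus {l : ℕ} (s : SignString l) : Prop :=
  Even (Finset.univ.filter fun i => s i = -1).card

/-- Strings with an even number of minus signs. -/
abbrev EvenString (l : ℕ) : Type := {s : SignString l // EvenMinus s}

/-- Exchange the symbols at positions `a` and `b`. -/
def exchange {l : ℕ} (a b : Fin l) (s : SignString l) : SignString l :=
  fun c => s (Equiv.swap a b c)

/-- Alter the symbols at positions `a` and `b`. -/
def alter {l : ℕ} (a b : Fin l) (s : SignString l) : SignString l :=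
  fun c => if c = a ∨ c = b then -s c else s c

namespace SpinHeap

variable {l : ℕ}

open Classical in
/-- The string of a proper ideal `F` of height `0`.  Put `G = F \ ⟨E(0, 0)⟩`, an ideal of the
subheap `E₀` of elements neither `≤ E(0, 0)` nor `≥ E(0, 1)`.  The first `l - 1` letters record the
steps of the binary path of `G`; the last letter is `+` if `g(G, l - 2) ≡ l - 1` modulo `4` (`G` is
even), and `-` otherwise. -/
noncomputable def spinString (F : Set (SpinHeap l)) : SignString l :=
  fun i =>
    if (i : ℕ) + 1 < l then
      if binaryPath (F \ Set.Iic (zeroElt l 0)) i < binaryPath (F \ Set.Iic (zeroElt l 0)) (i + 1)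
      then 1 else -1
    else
      if gFun (F \ Set.Iic (zeroElt l 0)) (l - 2) ≡ (l : ℤ) - 1 [ZMOD 4] then 1 else -1

/-- The pair consisting of the height of a proper ideal `I` and the string of the ideal
`φ^(-h(I)) (I)` of height `0` in its `⟨φ⟩`-orbit. -/
noncomputable def code (I : Ideals l) : ℤ × SignString l :=
  (height I.carrier, spinString ((phi l ^ (-height I.carrier)) '' I.carrier))

end SpinHeap

/-! The heap is a checkerboard strip. Labels 0 and 1 alternate in the left column, labels l-1 and l
in the right one, every other label has its own column, and a ≤ b holds exactly when the distance
between columns is at most the difference of layers (`le_iff_column`). A proper ideal is therefore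
the region under a lattice path with steps ±1 (`exists_isProfile`, `exists_ideal`). The inner
letters of the code are the steps of this path. The starting value modulo 4 gives the first letter,
and its quotient gives the height; the final value modulo 4 gives the last letter. These two letters
say which label tops each extreme column. The final value is the starting value plus the steps, so
the letters satisfy one congruence modulo 4, which is evenness of the number of minus signs. This
gives `bijOn_code`.

For the action, regard (t, s) as the affine function with linear part s and constant term 2t. The
generators on pairs become the affine reflections of type D_l^{(1)} (`affineWeight_simpleAct`), so
the Coxeter relations are inherited. A simple coroot takes only the values 2, -2 and 0 on these
functions, and they correspond to removing an element, adding one and doing nothing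
(`code_reflect`).

Faithfulness rests on root positivity (`rep_root_mem`): a nontrivial element cannot fix all simple
roots. An element fixing all even strings does fix them, because every simple root is, up to a
nonzero multiple, a difference of two weights of even strings. Consequently W_0, which preserves the
integer, embeds in the permutations of a finite set; comparing reflection representations identifies
it with the Weyl group of type D_l. It is transitive because every orbit contains a dominant string
and the only dominant even string is all plus. -/

/-! ### Reflection representations of simply laced Weyl groups -/

section Reflections

variable {P V : Type} [AddCommGroup V]

/-- The reflection `v ↦ v - f v • α`. -/
def reflectionMap (f : V →ₗ[ℤ] ℤ) (α : V) : Module.End ℤ V := LinearMap.id - f.smulRight α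

theorem reflectionMap_apply (f : V →ₗ[ℤ] ℤ) (α v : V) : reflectionMap f α v = v - f v • α := rfl

/-- `α` and `f` are simple roots and coroots realizing the simply laced Cartan matrix `A`. -/
structure IsSimplyLacedRealization (A : Matrix P P ℤ) (α : P → V) (f : P → V →ₗ[ℤ] ℤ) :
    Prop where
  apply_root : ∀ p q, f p (α q) = A p q
  diag : ∀ p, A p p = 2
  symm : ∀ p q, A p q = A q p
  offDiag : ∀ p q, p ≠ q → A p q = 0 ∨ A p q = -1

variable [DecidableEq P] {A : Matrix P P ℤ} {α : P → V} {f : P → V →ₗ[ℤ] ℤ}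

namespace IsSimplyLacedRealization

/-- In the simply laced case only the orders 1, 2 and 3 occur. Expanding the relation at a vector v
leaves a linear identity in v and the two roots. -/
theorem isLiftable (h : IsSimplyLacedRealization A α f) :
    (weylCoxeterMatrix A).IsLiftable fun p => reflectionMap (f p) (α p) := by
  intro p q
  have hpp := (h.apply_root p p).trans (h.diag p)
  have hqq := (h.apply_root q q).trans (h.diag q)
  have hpq := h.apply_root p q
  have hqp := (h.apply_root q p).trans (h.symm q p)
  by_cases e : p = q
  · subst e
    ext v
    simp only [weylCoxeterMatrix, Matrix.of_apply, if_true, pow_one, Module.End.mul_apply,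
      reflectionMap_apply, map_sub, map_smul, hpp, Module.End.one_apply]
    module
  · rcases h.offDiag p q e with h0 | h0
    · ext v
      rw [h0] at hpq hqp
      simp only [weylCoxeterMatrix, Matrix.of_apply, if_neg e, h.symm q p, h0, mul_zero, if_true,
        pow_two, Module.End.mul_apply, reflectionMap_apply, map_sub, map_smul, hpp, hqq, hpq, hqp,
        Module.End.one_apply]
      module
    · ext v
      rw [h0] at hpq hqp
      have h3 : (weylCoxeterMatrix A).M p q = 3 := by
        simp [weylCoxeterMatrix, e, h.symm q p, h0]
      simp only [h3, pow_succ, pow_zero, one_mul, Module.End.mul_apply, reflectionMap_apply,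
        map_sub, map_smul, hpp, hqq, hpq, hqp, Module.End.one_apply]
      module

/-- The reflection representation of the Weyl group. -/
noncomputable def rep (h : IsSimplyLacedRealization A α f) : WeylGroup A →* Module.End ℤ V :=
  (weylCoxeterMatrix A).toCoxeterSystem.lift ⟨_, h.isLiftable⟩

theorem rep_simple (h : IsSimplyLacedRealization A α f) (p : P) :
    h.rep (weylSimple A p) = reflectionMap (f p) (α p) :=
  (weylCoxeterMatrix A).toCoxeterSystem.lift_apply_simple h.isLiftable p

theorem rep_mul_simple_root (h : IsSimplyLacedRealization A α f) (w : WeylGroup A) (p q : P) :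
    h.rep (w * weylSimple A q) (α p) = h.rep w (α p) - A q p • h.rep w (α q) := by
  rw [map_mul, Module.End.mul_apply, rep_simple, reflectionMap_apply, h.apply_root, map_sub,
    map_smul]

/-- If multiplication by `s_p` on the right increases the length of `w`, then `w` sends the
simple root `α p` to a sum of simple roots. -/
theorem rep_root_mem (h : IsSimplyLacedRealization A α f) (w : WeylGroup A) (p : P)
    (hp : ¬ (weylCoxeterMatrix A).toCoxeterSystem.IsRightDescent w p) :
    h.rep w (α p) ∈ AddSubmonoid.closure (Set.range α) := by
  set cs := (weylCoxeterMatrix A).toCoxeterSystem with hcs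
  induction hn : cs.length w using Nat.strong_induction_on generalizing w p with
  | _ n ih =>
    by_cases hw : w = 1
    · subst hw
      rw [map_one]
      exact AddSubmonoid.subset_closure ⟨p, rfl⟩
    -- Write w = w' s_q with w' shorter. Then w α_p is w' α_p or w' (α_p + α_q), according as s_p
    -- and s_q commute or braid.
    obtain ⟨q, hq⟩ := cs.exists_rightDescent_of_ne_one hw
    have hpq : p ≠ q := by
      rintro rfl
      exact hp hq
    set w' := w * cs.simple q with hw'
    have hlen : cs.length w' + 1 = cs.length w := cs.isRightDescent_iff.1 hq
    have hp' : cs.length (w * cs.simple p) = cs.length w + 1 := cs.not_isRightDescent_iff.1 hp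
    have hww : w = w' * weylSimple A q := by
      rw [hw']; exact (cs.simple_mul_simple_cancel_right q).symm
    have hq' : ¬ cs.IsRightDescent w' q := by
      rw [← cs.isRightDescent_iff_not_isRightDescent_mul]; exact hq
    rw [hww, h.rep_mul_simple_root, h.symm q p]
    rcases h.offDiag p q hpq with h0 | h0
    · rw [h0, zero_smul, sub_zero]
      -- A descent of w' at p would be a descent of w at p, since w s_p = w' s_p s_q.
      refine ih _ (by omega) w' p (fun hd => ?_) rfl
      have hcomm : cs.simple q * cs.simple p = cs.simple p * cs.simple q := by
        have := cs.simple_mul_simple_pow p q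
        rw [show (weylCoxeterMatrix A).M p q = 2 by
          simp [weylCoxeterMatrix, hpq, h0], pow_two] at this
        have h2 := eq_inv_of_mul_eq_one_left this
        rw [mul_inv_rev, cs.inv_simple, cs.inv_simple] at h2
        exact h2.symm
      have e1 : w * cs.simple p = w' * cs.simple p * cs.simple q := by
        rw [mul_assoc, ← hcomm, ← mul_assoc, hw', cs.simple_mul_simple_cancel_right]
      have := cs.isRightDescent_iff.1 hd
      rcases cs.length_mul_simple (w' * cs.simple p) q with h1 | h1 <;> rw [← e1] at h1 <;> omega
    · rw [h0, neg_smul, one_smul, sub_neg_eq_add]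
      have mem_q := ih _ (by omega) w' q hq' rfl
      by_cases hd : cs.IsRightDescent w' p
      -- Here w' = w'' s_p and s_p (α_p + α_q) = α_q, so the image to be controlled is w'' α_q.
      · set w'' := w' * cs.simple p with hw''
        have hlen' : cs.length w'' + 1 = cs.length w' := cs.isRightDescent_iff.1 hd
        have hww' : w' = w'' * weylSimple A p := by
          rw [hw'']; exact (cs.simple_mul_simple_cancel_right p).symm
        have key : h.rep w' (α p) + h.rep w' (α q) = h.rep w'' (α q) := by
          rw [hww', h.rep_mul_simple_root, h.rep_mul_simple_root, h.diag, h0]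
          module
        rw [key]
        -- If q were a descent of w'', the braid relation w s_p = w'' s_q s_p s_q would bound the
        -- length of w s_p by that of w minus 1.
        refine ih _ (by omega) w'' q (fun hd' => ?_) rfl
        have hbraid : cs.simple p * cs.simple q * cs.simple p =
            cs.simple q * cs.simple p * cs.simple q := by
          have := cs.simple_mul_simple_pow p q
          rw [show (weylCoxeterMatrix A).M p q = 3 by
            simp [weylCoxeterMatrix, hpq, h.symm q p, h0], pow_succ, pow_two] at this
          have h2 : (cs.simple p * cs.simple q * cs.simple p) *
            (cs.simple q * cs.simple p * cs.simple q) = 1 := by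
            simpa only [mul_assoc] using this
          have h3 := eq_inv_of_mul_eq_one_left h2
          simpa only [mul_inv_rev, cs.inv_simple, mul_assoc] using h3
        have e1 : w * cs.simple p = w'' * cs.simple q * cs.simple p * cs.simple q := by
          calc w * cs.simple p = w'' * (cs.simple p * cs.simple q * cs.simple p) := by
                rw [hww, hww', ← mul_assoc, ← mul_assoc]; rfl
            _ = _ := by rw [hbraid, ← mul_assoc, ← mul_assoc]
        have h1 := cs.isRightDescent_iff.1 hd'
        have h2 := cs.length_mul_simple (w'' * cs.simple q) p
        have h3 := cs.length_mul_simple (w'' * cs.simple q * cs.simple p) q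
        rw [← e1] at h3
        omega
      · exact add_mem (ih _ (by omega) w' p hd rfl) mem_q

/-- If some functional is positive on all simple roots, an element of the Weyl group which fixes
the simple roots is trivial. -/
theorem eq_one_of_rep_root_eq (h : IsSimplyLacedRealization A α f) (ht : V →ₗ[ℤ] ℤ)
    (hpos : ∀ p, 0 < ht (α p)) (w : WeylGroup A) (hw : ∀ p, h.rep w (α p) = α p) : w = 1 := by
  set cs := (weylCoxeterMatrix A).toCoxeterSystem with hcs
  by_contra hne
  obtain ⟨p, hp⟩ := cs.exists_rightDescent_of_ne_one hne
  rw [cs.isRightDescent_iff_not_isRightDescent_mul] at hp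
  have hmem := h.rep_root_mem _ p hp
  -- Since w fixes α_p, the element w s_p negates it, whereas positivity puts the image in the cone
  -- where `ht` is nonnegative.
  have key : h.rep (w * cs.simple p) (α p) = - α p := by
    have := h.rep_mul_simple_root w p p
    rw [h.diag, hw] at this
    refine this.trans ?_
    module
  rw [key] at hmem
  have hnn : ∀ v ∈ AddSubmonoid.closure (Set.range α), 0 ≤ ht v := fun v hv => by
    induction hv using AddSubmonoid.closure_induction with
    | mem x hx => obtain ⟨q, rfl⟩ := hx; exact (hpos q).le
    | zero => simp
    | add x y _ _ hx hy => rw [map_add]; exact add_nonneg hx hy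
  have := hnn _ hmem
  have := hpos p
  rw [map_neg] at *
  omega

end IsSimplyLacedRealization

end Reflections

/-! ### The root system of type `D_l^{(1)}` -/

section AffineRoots

/-- The `i`-th coordinate of the linear part. -/
def linearCoord (i : ℕ) : (ℕ → ℤ) × ℤ →ₗ[ℤ] ℤ := LinearMap.proj i ∘ₗ LinearMap.fst ℤ (ℕ → ℤ) ℤ

theorem linearCoord_apply (i : ℕ) (v : (ℕ → ℤ) × ℤ) : linearCoord i v = v.1 i := rfl

/-- The simple roots of type `D_l^{(1)}`, as affine functions. -/
def affineDRoot (l p : ℕ) : (ℕ → ℤ) × ℤ :=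
  if p = 0 then (-Pi.single 0 1 - Pi.single 1 1, 1)
  else if p < l then (Pi.single (p - 1) 1 - Pi.single p 1, 0)
  else (Pi.single (l - 2) 1 + Pi.single (l - 1) 1, 0)

/-- The simple coroots of type `D_l^{(1)}`. -/
def affineDCoroot (l p : ℕ) : (ℕ → ℤ) × ℤ →ₗ[ℤ] ℤ :=
  if p = 0 then -linearCoord 0 - linearCoord 1
  else if p < l then linearCoord (p - 1) - linearCoord p
  else linearCoord (l - 2) + linearCoord (l - 1)

/-- A functional which is positive on all simple roots. -/
def alcoveFunctional (l : ℕ) : (ℕ → ℤ) × ℤ →ₗ[ℤ] ℤ :=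
  (∑ i ∈ Finset.range l, ((l : ℤ) - 1 - i) • linearCoord i) +
    (2 * l : ℤ) • LinearMap.snd ℤ (ℕ → ℤ) ℤ

theorem affineDMatrix_apply (l : ℕ) (p q : Fin (l + 1)) : affineDMatrix l p q =
    if (p : ℕ) = q then 2 else if affineDEdge l p q ∨ affineDEdge l q p then -1 else 0 := by
  simp [affineDMatrix, Fin.ext_iff]

theorem affineDCoroot_root {l : ℕ} (hl : 4 ≤ l) {p q : ℕ} (hp : p ≤ l) (hq : q ≤ l) :
    affineDCoroot l p (affineDRoot l q) =
      if p = q then 2 else if affineDEdge l p q ∨ affineDEdge l q p then -1 else 0 := by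
  have e0 : ∀ q, q = 0 → affineDRoot l q = (-Pi.single 0 1 - Pi.single 1 1, 1) :=
    fun q h => if_pos h
  have e1 : ∀ q, 0 < q → q < l → affineDRoot l q = (Pi.single (q - 1) 1 - Pi.single q 1, 0) :=
    fun q h h' => by rw [affineDRoot, if_neg h.ne', if_pos h']
  have e2 : ∀ q, q = l → affineDRoot l q = (Pi.single (l - 2) 1 + Pi.single (l - 1) 1, 0) :=
    fun q h => by rw [affineDRoot, if_neg (by omega), if_neg (by omega)]
  have f0 : ∀ p, p = 0 → affineDCoroot l p = -linearCoord 0 - linearCoord 1 :=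
    fun p h => if_pos h
  have f1 : ∀ p, 0 < p → p < l → affineDCoroot l p = linearCoord (p - 1) - linearCoord p :=
    fun q h h' => by rw [affineDCoroot, if_neg h.ne', if_pos h']
  have f2 : ∀ p, p = l → affineDCoroot l p = linearCoord (l - 2) + linearCoord (l - 1) :=
    fun p h => by rw [affineDCoroot, if_neg (by omega), if_neg (by omega)]
  unfold affineDEdge
  obtain hp0 | ⟨hp0, hpl⟩ | hpl : p = 0 ∨ (0 < p ∧ p < l) ∨ p = l := by omega
  all_goals obtain hq0 | ⟨hq0, hql⟩ | hql : q = 0 ∨ (0 < q ∧ q < l) ∨ q = l := by omega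
  all_goals first | rw [e0 _ hq0] | rw [e2 _ hql] | rw [e1 _ hq0 hql]
  all_goals first | rw [f0 _ hp0] | rw [f2 _ hpl] | rw [f1 _ hp0 hpl]
  all_goals simp only [LinearMap.add_apply, LinearMap.sub_apply, LinearMap.neg_apply,
    linearCoord_apply, Pi.add_apply, Pi.sub_apply, Pi.neg_apply, Pi.single_apply]
  all_goals clear e0 e1 e2 f0 f1 f2
  all_goals grind

theorem affineD_realization {l : ℕ} (hl : 4 ≤ l) :
    IsSimplyLacedRealization (affineDMatrix l) (fun p => affineDRoot l p)
      (fun p => affineDCoroot l p) where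
  apply_root p q := by
    rw [affineDMatrix_apply]
    exact affineDCoroot_root hl (by omega) (by omega)
  diag p := by simp [affineDMatrix]
  symm p q := by simp only [affineDMatrix_apply, eq_comm, or_comm]
  offDiag p q h := by
    rw [affineDMatrix_apply, if_neg (by simpa [Fin.ext_iff] using h)]
    split_ifs <;> simp

theorem cartanMatrix_D_apply {l : ℕ} (hl : 4 ≤ l) (i j : Fin l) :
    CartanMatrix.D l i j = affineDMatrix l i.succ j.succ := by
  rw [affineDMatrix_apply]
  have hi := i.isLt
  have hj := j.isLt
  simp only [CartanMatrix.D, affineDEdge, Matrix.of_apply, Fin.ext_iff, Fin.val_succ,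
    Nat.add_eq_zero_iff, one_ne_zero, and_false, false_and, false_or]
  rw [if_neg (show ¬ l ≤ 2 by omega)]
  split_ifs <;> omega

/-- Omitting root 0 leaves a realization of type D_l inside the same lattice, so the finite and
affine representations can be compared directly. -/
theorem D_realization {l : ℕ} (hl : 4 ≤ l) :
    IsSimplyLacedRealization (CartanMatrix.D l) (fun i => affineDRoot l (i + 1))
      (fun i => affineDCoroot l (i + 1)) where
  apply_root i j := by
    rw [cartanMatrix_D_apply hl]; exact (affineD_realization hl).apply_root i.succ j.succ
  diag i := by rw [cartanMatrix_D_apply hl]; exact (affineD_realization hl).diag _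
  symm i j := by
    rw [cartanMatrix_D_apply hl, cartanMatrix_D_apply hl]; exact (affineD_realization hl).symm _ _
  offDiag i j h := by
    rw [cartanMatrix_D_apply hl]
    exact (affineD_realization hl).offDiag _ _ fun e => h (Fin.succ_injective _ e)

/-- The value is 1 on every finite simple root. On root 0 the linear part contributes -(2l - 3) and
the constant term 2l, which leaves 3. -/
theorem alcoveFunctional_root_pos {l : ℕ} (hl : 4 ≤ l) (p : ℕ) (hp : p ≤ l) :
    0 < alcoveFunctional l (affineDRoot l p) := by
  have key : ∀ i, i < l → ∑ x ∈ Finset.range l, ((l : ℤ) - 1 - x) * (Pi.single i 1 : ℕ → ℤ) x =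
      (l : ℤ) - 1 - i := fun i hi => by
    rw [Finset.sum_eq_single i] <;> simp +contextual
    omega
  simp only [alcoveFunctional, affineDRoot]
  split_ifs <;>
  simp only [LinearMap.add_apply, LinearMap.sum_apply, LinearMap.smul_apply, linearCoord_apply,
    LinearMap.snd_apply, smul_eq_mul, Pi.add_apply, Pi.sub_apply, Pi.neg_apply, mul_add, mul_sub,
    mul_neg, Finset.sum_add_distrib, Finset.sum_sub_distrib, Finset.sum_neg_distrib]
  · rw [key 0 (by omega), key 1 (by omega)]; omega
  · rw [key _ (by omega), key _ (by omega)]; omega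
  · rw [key _ (by omega), key _ (by omega)]; omega

end AffineRoots

/-! ### The action on pairs of an integer and a string -/

section StringAction

variable {l : ℕ}

/-- The `i`-th letter of a string as an integer, extended by `0`. -/
def letter (s : SignString l) (i : ℕ) : ℤ := if h : i < l then (s ⟨i, h⟩ : ℤ) else 0

theorem letter_val (s : SignString l) (i : Fin l) : letter s i = s i := by simp [letter]

theorem letter_eq (s : SignString l) {i : ℕ} (h : i < l) : letter s i = 1 ∨ letter s i = -1 := by
  rw [letter, dif_pos h]
  rcases Int.units_eq_one_or (s ⟨i, h⟩) with e | e <;> simp [e]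

theorem letter_injective : Function.Injective (letter (l := l)) := fun s s' h => by
  ext i
  rw [← letter_val, ← letter_val, h]

theorem letter_exchange (a b : Fin l) (s : SignString l) (i : ℕ) : letter (exchange a b s) i =
    if i = a then letter s b else if i = b then letter s a else letter s i := by
  by_cases h : i < l
  · obtain ⟨i, rfl⟩ : ∃ j : Fin l, i = j := ⟨⟨i, h⟩, rfl⟩
    simp only [letter_val, exchange, Equiv.swap_apply_def, Fin.ext_iff]
    split_ifs <;> rfl
  · have ha : i ≠ a := by omega
    have hb : i ≠ b := by omega
    simp [letter, h, ha, hb]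

theorem letter_alter (a b : Fin l) (s : SignString l) (i : ℕ) : letter (alter a b s) i =
    if i = a ∨ i = b then -letter s i else letter s i := by
  by_cases h : i < l
  · obtain ⟨i, rfl⟩ : ∃ j : Fin l, i = j := ⟨⟨i, h⟩, rfl⟩
    simp only [letter_val, alter, Fin.ext_iff]
    split_ifs <;> simp
  · simp [letter, h]

theorem evenMinus_iff_prod (s : SignString l) : EvenMinus s ↔ ∏ i, s i = 1 := by
  have : ∀ i, s i = if s i = -1 then -1 else 1 := fun i => by
    rcases Int.units_eq_one_or (s i) with e | e <;> simp [e]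
  rw [Finset.prod_congr rfl fun i _ => this i, Finset.prod_ite, Finset.prod_const,
    Finset.prod_const_one, mul_one, EvenMinus]
  constructor
  · exact fun h => h.neg_one_pow
  · intro h
    by_contra h'
    rw [Nat.not_even_iff_odd] at h'
    rw [h'.neg_one_pow] at h
    exact absurd h (by decide)

theorem evenMinus_exchange {a b : Fin l} {s : SignString l} :
    EvenMinus (exchange a b s) ↔ EvenMinus s := by
  rw [evenMinus_iff_prod, evenMinus_iff_prod]
  exact (Equiv.prod_comp (Equiv.swap a b) s).congr_left

theorem evenMinus_alter {a b : Fin l} (hab : a ≠ b) {s : SignString l} :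
    EvenMinus (alter a b s) ↔ EvenMinus s := by
  rw [evenMinus_iff_prod, evenMinus_iff_prod]
  have : ∀ i, alter a b s i = (if i = a then -1 else 1) * (if i = b then -1 else 1) * s i := by
    intro i
    simp only [alter]
    by_cases h1 : i = a
    · simp [h1, hab]
    · by_cases h2 : i = b <;> simp [h1, h2, Ne.symm hab]
  simp only [this, Finset.prod_mul_distrib, Finset.prod_ite_eq', Finset.mem_univ, if_true]
  simp

/-- Pairs of an integer and a string as affine functions. -/
def affineWeight (x : ℤ × SignString l) : (ℕ → ℤ) × ℤ := (letter x.2, 2 * x.1)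

theorem affineWeight_injective : Function.Injective (affineWeight (l := l)) := fun x y h => by
  simp only [affineWeight, Prod.mk.injEq] at h
  exact Prod.ext (by omega) (letter_injective h.1)

/-- The generators of the Weyl group of type `D_l^{(1)}` on pairs of an integer and a string. -/
def simpleAct (hl : 4 ≤ l) (p : Fin (l + 1)) (x : ℤ × SignString l) : ℤ × SignString l :=
  if (p : ℕ) = 0 then
    if x.2 ⟨0, by omega⟩ = x.2 ⟨1, by omega⟩ then
      (x.1 + (x.2 ⟨0, by omega⟩ : ℤ), alter ⟨0, by omega⟩ ⟨1, by omega⟩ x.2)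
    else x
  else if h : (p : ℕ) < l then
    (x.1, exchange ⟨p - 1, by omega⟩ ⟨p, h⟩ x.2)
  else
    (x.1, alter ⟨l - 2, by omega⟩ ⟨l - 1, by omega⟩
      (exchange ⟨l - 2, by omega⟩ ⟨l - 1, by omega⟩ x.2))

/-- Letters are ±1, so the coroot is 0 or ±2, and subtracting that multiple of the root exchanges or
alters two letters. For p = 0 the constant term moves by 0 or ±2, which is why the integer is
doubled in `affineWeight`. -/
theorem affineWeight_simpleAct (hl : 4 ≤ l) (p : Fin (l + 1)) (x : ℤ × SignString l) :
    affineWeight (simpleAct hl p x) =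
      reflectionMap (affineDCoroot l p) (affineDRoot l p) (affineWeight x) := by
  obtain ⟨t, s⟩ := x
  obtain ⟨p, hp⟩ := p
  rw [reflectionMap_apply]
  simp only [simpleAct, affineDRoot, affineDCoroot]
  have e0 : (s ⟨0, by omega⟩ : ℤ) = letter s 0 := (letter_val s ⟨0, by omega⟩).symm
  have e1 : (s ⟨1, by omega⟩ : ℤ) = letter s 1 := (letter_val s ⟨1, by omega⟩).symm
  have c0 := letter_eq s (show 0 < l by omega)
  have c1 := letter_eq s (show 1 < l by omega)
  split_ifs with h1 h2 h3
  · have h2' : letter s 0 = letter s 1 := by rw [← e0, ← e1, h2]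
    refine Prod.ext (funext fun i => ?_) ?_
    · simp only [affineWeight, letter_alter, LinearMap.sub_apply, LinearMap.neg_apply,
        linearCoord_apply, Prod.fst_sub, Prod.smul_fst, Pi.sub_apply, Pi.smul_apply, Pi.neg_apply,
        Pi.single_apply, smul_eq_mul]
      rcases eq_or_ne i 0 with rfl | i0
      · simp; omega
      · rcases eq_or_ne i 1 with rfl | i1
        · simp; omega
        · simp [i0, i1]
    · simp only [affineWeight, LinearMap.sub_apply, LinearMap.neg_apply, e0,
        linearCoord_apply, Prod.snd_sub, Prod.smul_snd, smul_eq_mul]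
      omega
  · have h2' : letter s 0 ≠ letter s 1 := fun e => h2 (Units.ext (by rw [e0, e1, e]))
    have : (-linearCoord 0 - linearCoord 1) (affineWeight (t, s)) = 0 := by
      simp only [affineWeight, LinearMap.sub_apply, LinearMap.neg_apply, linearCoord_apply]
      omega
    rw [this, zero_smul, sub_zero]
  · refine Prod.ext (funext fun i => ?_) ?_
    · simp only [affineWeight, letter_exchange, LinearMap.sub_apply,
        linearCoord_apply, Prod.fst_sub, Prod.smul_fst, Pi.sub_apply, Pi.smul_apply,
        Pi.single_apply, smul_eq_mul]
      rcases eq_or_ne i (p - 1) with rfl | i0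
      · rw [if_pos rfl, if_pos rfl, if_neg (by omega)]; ring
      · rcases eq_or_ne i p with rfl | i1
        · simp [i0]
        · simp [i0, i1]
    · simp [affineWeight]
  · refine Prod.ext (funext fun i => ?_) ?_
    · simp only [affineWeight, letter_exchange, letter_alter, LinearMap.add_apply,
        linearCoord_apply, Prod.fst_sub, Prod.smul_fst, Pi.sub_apply, Pi.add_apply, Pi.smul_apply,
        Pi.single_apply, smul_eq_mul]
      rcases eq_or_ne i (l - 2) with rfl | i0
      · rw [if_pos (Or.inl rfl), if_pos rfl, if_pos rfl, if_neg (by omega)]; ring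
      · rcases eq_or_ne i (l - 1) with rfl | i1
        · simp [i0]
        · simp [i0, i1]
    · simp [affineWeight]

theorem simpleAct_involutive (hl : 4 ≤ l) (p : Fin (l + 1)) :
    Function.Involutive (simpleAct hl p) := fun x => by
  have := (affineD_realization hl).isLiftable p p
  rw [show (weylCoxeterMatrix (affineDMatrix l)).M p p = 1 from
    (weylCoxeterMatrix (affineDMatrix l)).diagonal p, pow_one] at this
  apply affineWeight_injective
  rw [affineWeight_simpleAct, affineWeight_simpleAct, ← Module.End.mul_apply, this,
    Module.End.one_apply]

/-- The relations hold for the reflections and pull back along the injection `affineWeight`. -/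
theorem simpleAct_isLiftable (hl : 4 ≤ l) : (weylCoxeterMatrix (affineDMatrix l)).IsLiftable
    fun p => (simpleAct_involutive hl p).toPerm := by
  intro p q
  have key : ∀ (n : ℕ) (x : ℤ × SignString l),
      affineWeight ((((simpleAct_involutive hl p).toPerm * (simpleAct_involutive hl q).toPerm :
        Equiv.Perm (ℤ × SignString l)) ^ n) x) =
      ((reflectionMap (affineDCoroot l p) (affineDRoot l p) *
        reflectionMap (affineDCoroot l q) (affineDRoot l q)) ^ n) (affineWeight x) := by
    intro n
    induction n with
    | zero => intro x; rfl
    | succ n ih =>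
      intro x
      rw [pow_succ, pow_succ, Equiv.Perm.mul_apply, ih, Module.End.mul_apply, Equiv.Perm.mul_apply,
        Function.Involutive.coe_toPerm, Function.Involutive.coe_toPerm, affineWeight_simpleAct,
        affineWeight_simpleAct, Module.End.mul_apply]
  ext1 x
  apply affineWeight_injective
  rw [key, (affineD_realization hl).isLiftable p q]
  rfl

/-- The action of the Weyl group of type `D_l^{(1)}` on pairs of an integer and a string. -/
noncomputable def stringAction (hl : 4 ≤ l) :
    WeylGroup (affineDMatrix l) →* Equiv.Perm (ℤ × SignString l) :=
  (weylCoxeterMatrix (affineDMatrix l)).toCoxeterSystem.lift ⟨_, simpleAct_isLiftable hl⟩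

theorem stringAction_simple (hl : 4 ≤ l) (p : Fin (l + 1)) (x : ℤ × SignString l) :
    stringAction hl (weylSimple (affineDMatrix l) p) x = simpleAct hl p x :=
  congrArg (fun e : Equiv.Perm _ => e x)
    ((weylCoxeterMatrix (affineDMatrix l)).toCoxeterSystem.lift_apply_simple
      (simpleAct_isLiftable hl) p)

theorem affineWeight_stringAction (hl : 4 ≤ l) (w : WeylGroup (affineDMatrix l))
    (x : ℤ × SignString l) :
    affineWeight (stringAction hl w x) = (affineD_realization hl).rep w (affineWeight x) := by
  induction w using (weylCoxeterMatrix (affineDMatrix l)).toCoxeterSystem.simple_induction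
    generalizing x with
  | simple p =>
    rw [CoxeterMatrix.toCoxeterSystem_simple, stringAction_simple, affineWeight_simpleAct,
      IsSimplyLacedRealization.rep_simple]
  | one => rw [map_one, map_one]; rfl
  | mul w w' ih ih' =>
    rw [map_mul, map_mul, Equiv.Perm.mul_apply, Module.End.mul_apply, ih, ih']

theorem evenMinus_simpleAct (hl : 4 ≤ l) (p : Fin (l + 1)) (x : ℤ × SignString l) :
    EvenMinus (simpleAct hl p x).2 ↔ EvenMinus x.2 := by
  unfold simpleAct
  split_ifs
  · exact evenMinus_alter (by simp [Fin.ext_iff])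
  · rfl
  · exact evenMinus_exchange
  · exact (evenMinus_alter (by simp [Fin.ext_iff]; omega)).trans evenMinus_exchange

theorem evenMinus_stringAction (hl : 4 ≤ l) (w : WeylGroup (affineDMatrix l))
    (x : ℤ × SignString l) : EvenMinus (stringAction hl w x).2 ↔ EvenMinus x.2 := by
  induction w using (weylCoxeterMatrix (affineDMatrix l)).toCoxeterSystem.simple_induction
    generalizing x with
  | simple p =>
    rw [CoxeterMatrix.toCoxeterSystem_simple, stringAction_simple, evenMinus_simpleAct]
  | one => rw [map_one]; rfl
  | mul w w' ih ih' => rw [map_mul, Equiv.Perm.mul_apply, ih, ih']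

theorem evenMinus_one : EvenMinus (1 : SignString l) := by
  simp [evenMinus_iff_prod]

/-- At the vertices 0 and l the coroot is plus or minus a sum of two letters, so the all-plus string
serves. Otherwise the letters p - 1 and p must differ: one minus goes at p, and a second one, away
from both, restores evenness. -/
theorem exists_even_coroot_ne_zero (hl : 4 ≤ l) (p : Fin (l + 1)) :
    ∃ s : SignString l, EvenMinus s ∧ ∀ t : ℤ, affineDCoroot l p (affineWeight (t, s)) ≠ 0 := by
  obtain ⟨p, hp⟩ := p
  have hone : ∀ i < l, letter (1 : SignString l) i = 1 := fun i hi => by simp [letter, hi]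
  by_cases h : 0 < p ∧ p < l
  · obtain ⟨k, hk, hk1, hk2⟩ : ∃ k < l, k ≠ p - 1 ∧ k ≠ p := by
      rcases eq_or_ne p 1 with rfl | h1
      · exact ⟨2, by omega, by omega, by omega⟩
      · exact ⟨0, by omega, by omega, by omega⟩
    refine ⟨alter ⟨p, h.2⟩ ⟨k, hk⟩ 1,
      (evenMinus_alter (by simpa [Fin.ext_iff] using hk2.symm)).2 evenMinus_one, fun t => ?_⟩
    simp only [affineDCoroot, if_neg h.1.ne', if_pos h.2, LinearMap.sub_apply, linearCoord_apply,
      affineWeight, letter_alter]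
    rw [if_neg (by omega), if_pos (by simp), hone _ h.2, hone _ (by omega)]
    norm_num
  · refine ⟨1, evenMinus_one, fun t => ?_⟩
    simp only [affineDCoroot]
    split_ifs
    · simp only [affineWeight, LinearMap.sub_apply, LinearMap.neg_apply, linearCoord_apply]
      rw [hone _ (by omega), hone _ (by omega)]; norm_num
    · omega
    · simp only [affineWeight, LinearMap.add_apply, linearCoord_apply]
      rw [hone _ (by omega), hone _ (by omega)]; norm_num

/-- The action on pairs of an integer and an even string is faithful. -/
theorem eq_one_of_stringAction_eq (hl : 4 ≤ l) (w : WeylGroup (affineDMatrix l))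
    (hw : ∀ (t : ℤ) (u : EvenString l), stringAction hl w (t, u) = (t, (u : SignString l))) :
    w = 1 := by
  refine (affineD_realization hl).eq_one_of_rep_root_eq (alcoveFunctional l)
    (fun p => alcoveFunctional_root_pos hl p (by omega)) w fun p => ?_
  obtain ⟨s, hs, hne⟩ := exists_even_coroot_ne_zero hl p
  have hw' : ∀ x : ℤ × SignString l, EvenMinus x.2 →
      (affineD_realization hl).rep w (affineWeight x) = affineWeight x := fun x hx => by
    rw [← affineWeight_stringAction hl]
    exact congrArg _ (hw x.1 ⟨x.2, hx⟩)
  -- The weights of an even string and of its reflection are both fixed. Their difference is a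
  -- nonzero multiple of the root, and the lattice is torsion free.
  have h1 := hw' (0, s) hs
  have h2 := hw' (simpleAct hl p (0, s)) ((evenMinus_simpleAct hl p _).2 hs)
  rw [affineWeight_simpleAct, reflectionMap_apply, map_sub, map_smul, h1] at h2
  exact smul_right_injective _ (hne 0) (sub_right_injective h2)

end StringAction

/-! ### The finite parabolic subgroup -/

section FiniteParabolic

variable {l : ℕ}

theorem stringAction_of_mem (hl : 4 ≤ l) {w : WeylGroup (affineDMatrix l)}
    (hw : w ∈ finiteWeylSubgroup l) (t : ℤ) (s : SignString l) :
    stringAction hl w (t, s) = (t, (stringAction hl w (0, s)).2) := by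
  induction hw using Subgroup.closure_induction generalizing t s with
  | mem x hx =>
    obtain ⟨p, hp, rfl⟩ := hx
    have hp' : (p : ℕ) ≠ 0 := fun h => hp (Fin.ext h)
    rw [stringAction_simple, stringAction_simple]
    simp only [simpleAct, if_neg hp']
    split_ifs <;> rfl
  | one => rw [map_one]; rfl
  | mul x y _ _ hx hy =>
    rw [map_mul, Equiv.Perm.mul_apply, Equiv.Perm.mul_apply, hy t, hx t, hy 0]
  -- The inverse keeps the integer because x does. Its string does not depend on t, since x sends
  -- that string, paired with 0, to (0, s) and is injective.
  | inv x _ hx =>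
    have key : ∀ t s, (stringAction hl x)⁻¹ (t, s) = (t, ((stringAction hl x)⁻¹ (t, s)).2) := by
      intro t s
      have h1 : stringAction hl x ((stringAction hl x)⁻¹ (t, s)) = (t, s) :=
        (stringAction hl x).apply_symm_apply (t, s)
      rw [hx _ ((stringAction hl x)⁻¹ (t, s)).2] at h1
      exact Prod.ext (Prod.mk.inj h1).1 rfl
    rw [map_inv, key t s]
    refine Prod.ext rfl ?_
    have h1 : stringAction hl x ((stringAction hl x)⁻¹ (t, s)) = (t, s) :=
      (stringAction hl x).apply_symm_apply (t, s)
    rw [key t s, hx] at h1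
    have h2 : stringAction hl x (0, ((stringAction hl x)⁻¹ (t, s)).2) = (0, s) := by
      rw [hx]
      exact Prod.ext rfl (Prod.mk.inj h1).2
    show ((stringAction hl x)⁻¹ (t, s)).2 = _
    have h3 := (stringAction hl x).symm_apply_apply (0, ((stringAction hl x)⁻¹ (t, s)).2)
    rw [h2] at h3
    exact (congrArg Prod.snd h3).symm

/-- The action of the finite parabolic subgroup on even strings. -/
noncomputable def finiteAction (hl : 4 ≤ l) :
    finiteWeylSubgroup l →* Equiv.Perm (EvenString l) :=
  MonoidHom.toHomPerm
    { toFun := fun w u => ⟨(stringAction hl w (0, u)).2, (evenMinus_stringAction hl w _).2 u.2⟩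
      map_one' := by
        funext u
        exact Subtype.ext (by simp; rfl)
      map_mul' := fun w w' => by
        funext u
        refine Subtype.ext ?_
        change (stringAction hl (w * w' : WeylGroup (affineDMatrix l)) (0, u)).2 =
          (stringAction hl w (0, (stringAction hl w' (0, u)).2)).2
        rw [map_mul, Equiv.Perm.mul_apply, stringAction_of_mem hl w'.2] }

theorem stringAction_eq_finiteAction (hl : 4 ≤ l) (w : finiteWeylSubgroup l) (t : ℤ)
    (u : EvenString l) :
    stringAction hl w (t, u) = (t, (finiteAction hl w u : SignString l)) :=
  stringAction_of_mem hl w.2 t u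

theorem finiteAction_injective (hl : 4 ≤ l) : Function.Injective (finiteAction hl) := by
  rw [injective_iff_map_eq_one]
  intro w hw
  refine Subtype.ext (eq_one_of_stringAction_eq hl w fun t u => ?_)
  rw [stringAction_eq_finiteAction, hw]
  rfl

theorem finite_finiteWeylSubgroup (hl : 4 ≤ l) : Finite (finiteWeylSubgroup l) :=
  Finite.of_injective _ (finiteAction_injective hl)

/-- Dominance makes the letters weakly decreasing with the last two not both minus. So all letters
but the last are plus, and evenness settles the last. -/
theorem eq_one_of_dominant (hl : 4 ≤ l) {s : SignString l} (hs : EvenMinus s)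
    (hdom : ∀ i : Fin l, 0 ≤ affineDCoroot l (i + 1) (affineWeight (0, s))) : s = 1 := by
  have hstep : ∀ i, i + 1 < l → letter s (i + 1) ≤ letter s i := fun i hi => by
    have := hdom ⟨i, by omega⟩
    simp only [affineDCoroot, if_neg (Nat.succ_ne_zero _), if_pos hi, LinearMap.sub_apply,
      linearCoord_apply, affineWeight, Nat.add_sub_cancel] at this
    omega
  have hlast : 0 ≤ letter s (l - 2) + letter s (l - 1) := by
    have := hdom ⟨l - 1, by omega⟩
    simp only [affineDCoroot, if_neg (Nat.succ_ne_zero _),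
      if_neg (show ¬ l - 1 + 1 < l by omega), LinearMap.add_apply,
      linearCoord_apply, affineWeight] at this
    exact this
  have hmono : ∀ d i, i + d < l → letter s (i + d) ≤ letter s i := fun d => by
    induction d with
    | zero => intro i _; exact le_rfl
    | succ d ih => intro i hi; exact (hstep (i + d) hi).trans (ih i (by omega))
  have hone : ∀ i, i + 1 < l → letter s i = 1 := fun i hi => by
    have h1 := letter_eq s (show i < l by omega)
    have h2 := letter_eq s (show l - 1 < l by omega)
    have h3 := hmono (l - 2 - i) i (by omega)
    rw [show i + (l - 2 - i) = l - 2 by omega] at h3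
    have h4 := hstep (l - 2) (by omega)
    rw [show l - 2 + 1 = l - 1 by omega] at h4
    omega
  have hunit : ∀ i : Fin l, (i : ℕ) + 1 < l → s i = 1 := fun i hi =>
    Units.ext (by rw [← letter_val, hone i hi]; rfl)
  funext i
  by_cases hi : (i : ℕ) + 1 < l
  · exact hunit i hi
  · rw [evenMinus_iff_prod, Finset.prod_eq_single i
      (fun j _ hj => hunit j (by have := Fin.val_ne_of_ne hj; omega)) (by simp)] at hs
    exact hs

theorem finiteAction_simple (hl : 4 ≤ l) (i : Fin l) (u : EvenString l) :
    (finiteAction hl (finiteSimple l i) u : SignString l) = (simpleAct hl i.succ (0, u)).2 := by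
  rw [← stringAction_simple]
  rfl

/-- Choose a string in the orbit that maximizes the alcove functional. A negative coroot there would
let a reflection add a positive multiple of a simple root and increase the functional, so the
maximum is dominant. -/
theorem exists_finiteAction_eq_one (hl : 4 ≤ l) (u : EvenString l) :
    ∃ w, finiteAction hl w u = ⟨1, evenMinus_one⟩ := by
  obtain ⟨v, ⟨w, rfl⟩, hmax⟩ := Set.exists_max_image (Set.range fun w => finiteAction hl w u)
    (fun v : EvenString l => alcoveFunctional l (affineWeight (0, (v : SignString l)))) (Set.toFinite _) ⟨_, 1, rfl⟩
  refine ⟨w, Subtype.ext (eq_one_of_dominant hl (finiteAction hl w u).2 fun i => ?_)⟩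
  have h := hmax _ ⟨finiteSimple l i * w, rfl⟩
  have hpos := alcoveFunctional_root_pos hl (i + 1) (by omega)
  have hx := stringAction_eq_finiteAction hl (finiteSimple l i) 0 (finiteAction hl w u)
  have hs := stringAction_simple hl i.succ (0, (finiteAction hl w u : SignString l))
  have hact : affineWeight (0, (finiteAction hl (finiteSimple l i * w) u : SignString l)) =
      reflectionMap (affineDCoroot l (i + 1)) (affineDRoot l (i + 1))
        (affineWeight (0, (finiteAction hl w u : SignString l))) := by
    rw [map_mul, Equiv.Perm.mul_apply, ← hx]
    exact (congrArg _ hs).trans (affineWeight_simpleAct hl i.succ _)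
  rw [hact, reflectionMap_apply, map_sub, map_smul, smul_eq_mul] at h
  by_contra hneg
  nlinarith

theorem finiteAction_transitive (hl : 4 ≤ l) (u v : EvenString l) :
    ∃ w, finiteAction hl w u = v := by
  obtain ⟨w, hw⟩ := exists_finiteAction_eq_one hl u
  obtain ⟨w', hw'⟩ := exists_finiteAction_eq_one hl v
  refine ⟨w'⁻¹ * w, ?_⟩
  rw [map_mul, map_inv, Equiv.Perm.mul_apply, hw, ← hw']
  exact (finiteAction hl w').symm_apply_apply v

/-! ### The parabolic subgroup as the Weyl group of type D_l -/

theorem weylCoxeterMatrix_D (hl : 4 ≤ l) (i j : Fin l) :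
    weylCoxeterMatrix (CartanMatrix.D l) i j =
      weylCoxeterMatrix (affineDMatrix l) i.succ j.succ := by
  simp only [weylCoxeterMatrix, Matrix.of_apply, cartanMatrix_D_apply hl, Fin.succ_inj]

theorem finiteSimple_isLiftable (hl : 4 ≤ l) :
    (weylCoxeterMatrix (CartanMatrix.D l)).IsLiftable (finiteSimple l) := fun i j => by
  refine Subtype.ext ?_
  rw [weylCoxeterMatrix_D hl]
  exact (weylCoxeterMatrix (affineDMatrix l)).toCoxeterSystem.simple_mul_simple_pow i.succ j.succ

/-- The Weyl group of type `D_l` maps to the finite parabolic subgroup. -/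
noncomputable def weylGroupDHom (hl : 4 ≤ l) :
    WeylGroup (CartanMatrix.D l) →* finiteWeylSubgroup l :=
  (weylCoxeterMatrix (CartanMatrix.D l)).toCoxeterSystem.lift ⟨_, finiteSimple_isLiftable hl⟩

theorem weylGroupDHom_simple (hl : 4 ≤ l) (i : Fin l) :
    weylGroupDHom hl (weylSimple (CartanMatrix.D l) i) = finiteSimple l i :=
  (weylCoxeterMatrix (CartanMatrix.D l)).toCoxeterSystem.lift_apply_simple
    (finiteSimple_isLiftable hl) i

theorem rep_weylGroupDHom (hl : 4 ≤ l) (w : WeylGroup (CartanMatrix.D l)) :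
    (affineD_realization hl).rep (weylGroupDHom hl w) = (D_realization hl).rep w := by
  induction w using (weylCoxeterMatrix (CartanMatrix.D l)).toCoxeterSystem.simple_induction with
  | simple i =>
    rw [CoxeterMatrix.toCoxeterSystem_simple, weylGroupDHom_simple,
      IsSimplyLacedRealization.rep_simple]
    exact (affineD_realization hl).rep_simple i.succ
  | one => rw [map_one, map_one, Subgroup.coe_one, map_one]
  | mul w w' ih ih' => rw [map_mul, map_mul, Subgroup.coe_mul, map_mul, ih, ih']

/-- The reflection representation of type D_l factors through this map and detects the identity, so
the kernel is trivial. The image contains the generators of W_0. -/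
theorem weylGroupDHom_bijective (hl : 4 ≤ l) : Function.Bijective (weylGroupDHom hl) := by
  constructor
  · rw [injective_iff_map_eq_one]
    intro w hw
    refine (D_realization hl).eq_one_of_rep_root_eq (alcoveFunctional l)
      (fun i => alcoveFunctional_root_pos hl (i + 1) (by omega)) w fun i => ?_
    rw [← rep_weylGroupDHom hl, hw, Subgroup.coe_one, map_one]
    rfl
  · rintro ⟨w, hw⟩
    have hle : finiteWeylSubgroup l ≤ ((finiteWeylSubgroup l).subtype.comp
        (weylGroupDHom hl)).range := by
      refine (Subgroup.closure_le _).2 ?_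
      rintro _ ⟨p, hp, rfl⟩
      obtain ⟨i, rfl⟩ := Fin.exists_succ_eq.2 hp
      exact ⟨weylSimple (CartanMatrix.D l) i, by
        rw [MonoidHom.comp_apply, weylGroupDHom_simple]; rfl⟩
    obtain ⟨w', rfl⟩ := hle hw
    exact ⟨w', rfl⟩

theorem exists_weylGroupD_equiv (hl : 4 ≤ l) :
    ∃ e : WeylGroup (CartanMatrix.D l) ≃* finiteWeylSubgroup l,
      ∀ i : Fin l, e (weylSimple (CartanMatrix.D l) i) = finiteSimple l i :=
  ⟨MulEquiv.ofBijective _ (weylGroupDHom_bijective hl), weylGroupDHom_simple hl⟩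

end FiniteParabolic

/-! ### The spin-type heap as a grid -/

namespace SpinHeap

variable {l : ℕ}

/-- The column in which the elements labelled `p` stand. -/
def labelColumn (l p : ℕ) : ℕ := if p = l then l - 2 else p - 1

theorem column_eq (a : SpinHeap l) : a.column = labelColumn l a.label := rfl

theorem label_le (a : SpinHeap l) : (a.label : ℕ) ≤ l := Nat.le_of_lt_succ a.label.isLt

theorem occursInLayer_iff (hl : 4 ≤ l) {p : ℕ} (hp : p ≤ l) {k : ℤ} : OccursInLayer l p k ↔
    (p = 0 → k % 4 = 1) ∧ (p = 1 → k % 4 = 3) ∧ (p + 1 = l → (k - l - 3) % 4 = 0) ∧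
      (p = l → (k - l - 1) % 4 = 0) ∧ (2 ≤ p → p + 2 ≤ l → (k - p) % 2 = 0) := by
  unfold OccursInLayer
  simp only [Int.ModEq]
  split_ifs <;> omega

theorem occurs_cases (hl : 4 ≤ l) (a : SpinHeap l) :
    ((a.label : ℕ) = 0 → a.rank % 4 = 1) ∧ ((a.label : ℕ) = 1 → a.rank % 4 = 3) ∧
      ((a.label : ℕ) + 1 = l → (a.rank - l - 3) % 4 = 0) ∧
      ((a.label : ℕ) = l → (a.rank - l - 1) % 4 = 0) ∧
      (2 ≤ (a.label : ℕ) → (a.label : ℕ) + 2 ≤ l → (a.rank - (a.label : ℕ)) % 2 = 0) :=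
  (occursInLayer_iff hl a.label_le).1 a.occurs

theorem column_le (hl : 4 ≤ l) (a : SpinHeap l) : a.column + 2 ≤ l := by
  have := a.label_le
  rw [column_eq, labelColumn]
  split_ifs <;> omega

theorem rank_parity (hl : 4 ≤ l) (a : SpinHeap l) : (a.rank - a.column - 1) % 2 = 0 := by
  have := a.label_le
  have := occurs_cases hl a
  rw [column_eq, labelColumn]
  split_ifs <;> omega

/-- Only the two extreme columns carry two labels, and there the layer modulo 4 tells the labels
apart. -/
theorem eq_of_column_eq (hl : 4 ≤ l) {a b : SpinHeap l} (hc : a.column = b.column)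
    (hr : a.rank = b.rank) : a = b := by
  have := a.label_le
  have := b.label_le
  have := occurs_cases hl a
  have := occurs_cases hl b
  rw [column_eq, column_eq, labelColumn, labelColumn] at hc
  exact SpinHeap.ext (Fin.ext (by split_ifs at hc <;> omega)) hr

theorem exists_of_occurs (p : ℕ) (hp : p ≤ l) (k : ℤ) (h : OccursInLayer l p k) :
    ∃ a : SpinHeap l, (a.label : ℕ) = p ∧ a.column = labelColumn l p ∧ a.rank = k :=
  ⟨⟨⟨p, by omega⟩, k, h⟩, rfl, rfl, rfl⟩

theorem exists_of_parity (hl : 4 ≤ l) {i : ℕ} (hi : i + 2 ≤ l) {k : ℤ} (hk : (k - i - 1) % 2 = 0) :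
    ∃ a : SpinHeap l, a.column = i ∧ a.rank = k := by
  obtain ⟨p, hp, hc, ho⟩ : ∃ p ≤ l, labelColumn l p = i ∧ OccursInLayer l p k := by
    by_cases h0 : i = 0 ∧ k % 4 = 1
    · refine ⟨0, by omega, ?_, (occursInLayer_iff hl (by omega)).2 (by omega)⟩
      rw [labelColumn, if_neg (by omega)]; omega
    by_cases h1 : i + 2 = l ∧ (k - l - 1) % 4 = 0
    · refine ⟨l, le_rfl, ?_, (occursInLayer_iff hl le_rfl).2 (by omega)⟩
      rw [labelColumn, if_pos rfl]; omega
    · refine ⟨i + 1, by omega, ?_, (occursInLayer_iff hl (by omega)).2 (by omega)⟩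
      rw [labelColumn, if_neg (by omega)]; omega
  obtain ⟨a, -, ha, hr⟩ := exists_of_occurs p hp k ho
  exact ⟨a, ha.trans hc, hr⟩

/-- Folding each fork of the diagram into one column turns the diagram into a line, and the two
labels of a fork have the same neighbour. -/
theorem affineDEdge_iff (hl : 4 ≤ l) (p q : ℕ) (hp : p ≤ l) (hq : q ≤ l) :
    affineDEdge l p q ∨ affineDEdge l q p ↔
      labelColumn l p = labelColumn l q + 1 ∨ labelColumn l q = labelColumn l p + 1 := by
  unfold affineDEdge labelColumn
  split_ifs <;> omega

theorem affineDMatrix_label (hl : 4 ≤ l) (a b : SpinHeap l) :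
    affineDMatrix l a.label b.label = if a.label = b.label then 2
      else if a.column = b.column + 1 ∨ b.column = a.column + 1 then -1 else 0 := by
  rw [affineDMatrix_apply]
  simp only [affineDEdge_iff hl _ _ a.label_le b.label_le, column_eq, Fin.ext_iff]
  split_ifs <;> simp only [*, if_true, if_false]

theorem affineDMatrix_ne_zero_iff (hl : 4 ≤ l) (a b : SpinHeap l) :
    affineDMatrix l a.label b.label ≠ 0 ↔
      a.label = b.label ∨ a.column = b.column + 1 ∨ b.column = a.column + 1 := by
  rw [affineDMatrix_label hl]
  split_ifs with h1 h2
  · simp [h1]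
  · simp [h2]
  · simp [h1, h2]

/-- The heap order in grid coordinates. -/
theorem le_iff_column (hl : 4 ≤ l) (a b : SpinHeap l) : a ≤ b ↔
    (a.column : ℤ) - b.column ≤ b.rank - a.rank ∧ (b.column : ℤ) - a.column ≤ b.rank - a.rank := by
  constructor
  · intro h
    have h' : ReflTransGen Below a b := h
    induction h' with
    | refl => omega
    | @tail b c _ hbc ih =>
      have h1 := ih ‹_›
      have h2 := hbc.1
      rcases (affineDMatrix_ne_zero_iff hl b c).1 hbc.2 with h | h | h
      · have : b.column = c.column := by rw [column_eq, column_eq, h]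
        omega
      · omega
      · omega
  · intro h
    change ReflTransGen Below a b
    induction hn : (b.rank - a.rank).toNat generalizing a with
    | zero => rw [eq_of_column_eq hl (a := a) (b := b) (by omega) (by omega)]
    | succ n ih =>
      have ha := a.rank_parity hl
      have hb := b.rank_parity hl
      have hca := a.column_le hl
      have hcb := b.column_le hl
      -- Climb one layer towards the column of b. If the columns agree, parity leaves at least two
      -- layers to climb, so either side inside the strip will do.
      obtain ⟨i, hi, hia, hib⟩ : ∃ i, i + 2 ≤ l ∧ (a.column = i + 1 ∨ i = a.column + 1) ∧
          (i : ℤ) - b.column ≤ b.rank - (a.rank + 1) ∧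
          (b.column : ℤ) - i ≤ b.rank - (a.rank + 1) := by
        by_cases h1 : a.column < b.column ∨ a.column = 0
        · exact ⟨a.column + 1, by omega⟩
        · exact ⟨a.column - 1, by omega⟩
      obtain ⟨c, hc, hr⟩ := exists_of_parity hl hi (k := a.rank + 1) (by omega)
      refine ReflTransGen.head (b := c) ⟨by omega, ?_⟩ (ih c (by omega) (by omega))
      rw [affineDMatrix_ne_zero_iff hl]
      omega

theorem lt_iff_column (hl : 4 ≤ l) (a b : SpinHeap l) : a < b ↔ a.rank < b.rank ∧
    (a.column : ℤ) - b.column ≤ b.rank - a.rank ∧ (b.column : ℤ) - a.column ≤ b.rank - a.rank := by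
  rw [lt_iff_le_and_ne, le_iff_column hl]
  constructor
  · rintro ⟨h, hne⟩
    refine ⟨?_, h⟩
    by_contra hr
    exact hne (eq_of_column_eq hl (by omega) (by omega))
  · rintro ⟨hr, h⟩
    exact ⟨h, fun e => by rw [e] at hr; exact lt_irrefl _ hr⟩

/-- Every covering pair consists of diagonally adjacent positions. -/
theorem covBy_iff (hl : 4 ≤ l) (a b : SpinHeap l) : a ⋖ b ↔
    b.rank = a.rank + 1 ∧ (a.column = b.column + 1 ∨ b.column = a.column + 1) := by
  have hap := a.rank_parity hl
  have hbp := b.rank_parity hl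
  have hca := a.column_le hl
  have hcb := b.column_le hl
  constructor
  · rintro ⟨hlt, hcov⟩
    rw [lt_iff_column hl] at hlt
    by_contra hne
    obtain ⟨i, hi, hia, hib⟩ : ∃ i, i + 2 ≤ l ∧ (a.column = i + 1 ∨ i = a.column + 1) ∧
        (i : ℤ) - b.column ≤ b.rank - (a.rank + 1) ∧
        (b.column : ℤ) - i ≤ b.rank - (a.rank + 1) := by
      by_cases h1 : a.column < b.column ∨ a.column = 0
      · exact ⟨a.column + 1, by omega⟩
      · exact ⟨a.column - 1, by omega⟩
    obtain ⟨c, hc, hr⟩ := exists_of_parity hl hi (k := a.rank + 1) (by omega)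
    exact hcov ((lt_iff_column hl a c).2 (by omega)) ((lt_iff_column hl c b).2 (by omega))
  · rintro ⟨hr, hc⟩
    refine ⟨(lt_iff_column hl a b).2 (by omega), fun c hac hcb => ?_⟩
    rw [lt_iff_column hl] at hac hcb
    omega

/-! ### The axioms of a full heap -/

theorem exists_rank_gt (p : Fin (l + 1)) (n : ℤ) :
    ∃ a : SpinHeap l, a.label = p ∧ n < a.rank := by
  obtain ⟨a, ha⟩ : ∃ a : SpinHeap l, a.label = p := by
    obtain ⟨k, hk⟩ : ∃ k : ℤ, OccursInLayer l p k := by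
      unfold OccursInLayer
      split_ifs <;> exact ⟨_, rfl⟩
    exact ⟨⟨p, k, hk⟩, rfl⟩
  refine ⟨translate (n.natAbs + a.rank.natAbs + 1) a, ha, ?_⟩
  simp only [translate]
  omega

theorem exists_rank_lt (p : Fin (l + 1)) (n : ℤ) :
    ∃ a : SpinHeap l, a.label = p ∧ a.rank < n := by
  obtain ⟨a, ha, -⟩ := exists_rank_gt p 0
  refine ⟨translate (-(n.natAbs + a.rank.natAbs + 1)) a, ha, ?_⟩
  simp only [translate]
  omega

theorem rank_le_of_le (hl : 4 ≤ l) {a b : SpinHeap l} (h : a ≤ b) : a.rank ≤ b.rank := by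
  have := (le_iff_column hl a b).1 h
  omega

theorem isHeap (hl : 4 ≤ l) : IsHeap (affineDMatrix l) (label (l := l)) where
  finite_Icc a b := by
    refine Set.Finite.of_finite_image (f := fun c : SpinHeap l => (c.label, c.rank)) ?_ ?_
    · refine (Set.finite_univ.prod (Set.finite_Icc a.rank b.rank)).subset ?_
      rintro _ ⟨c, hc, rfl⟩
      exact ⟨Set.mem_univ _, rank_le_of_le hl hc.1, rank_le_of_le hl hc.2⟩
    · intro c _ d _ h
      exact SpinHeap.ext (Prod.mk.inj h).1 (Prod.mk.inj h).2
  comparable a b h := by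
    have ha := a.rank_parity hl
    have hb := b.rank_parity hl
    have hc : a.column = b.column ∨ a.column = b.column + 1 ∨ b.column = a.column + 1 :=
      ((affineDMatrix_ne_zero_iff hl a b).1 h).imp_left fun h => by rw [column_eq, column_eq, h]
    rw [le_iff_column hl, le_iff_column hl]
    omega
  le_iff a b := by
    constructor
    · intro h
      have h' : ReflTransGen Below a b := h
      refine TransGen.head' (b := a) ⟨le_rfl, by simp [affineDMatrix]⟩ ?_
      exact ReflTransGen.mono (p := fun x y => x ≤ y ∧ affineDMatrix l x.label y.label ≠ 0)
        (fun x y hxy => ⟨(ReflTransGen.single hxy : ReflTransGen Below x y), hxy.2⟩) _ _ h'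
    · intro h
      induction h with
      | single h => exact h.1
      | tail _ h ih => exact ih.trans h.1

theorem isFibredHeap (hl : 4 ≤ l) : IsFibredHeap (affineDMatrix l) (label (l := l)) where
  toIsHeap := isHeap hl
  not_bddAbove := by
    rintro p ⟨b, hb⟩
    obtain ⟨a, ha, hr⟩ := exists_rank_gt p b.rank
    exact absurd (rank_le_of_le hl (hb ha)) hr.not_ge
  not_bddBelow := by
    rintro p ⟨b, hb⟩
    obtain ⟨a, ha, hr⟩ := exists_rank_lt p b.rank
    exact absurd (rank_le_of_le hl (hb ha)) hr.not_ge
  exists_cover := by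
    rintro p q hpq hA a rfl
    have hq : (q : ℕ) ≤ l := Nat.le_of_lt_succ q.isLt
    have ha := occurs_cases hl a
    have hal := a.label_le
    rw [affineDMatrix_apply, if_neg fun h => hpq (Fin.ext h)] at hA
    have hedge : affineDEdge l a.label q ∨ affineDEdge l q a.label := by
      by_contra h
      exact hA (if_neg h)
    have hcol := (affineDEdge_iff hl _ _ hal hq).1 hedge
    have hocc : OccursInLayer l q (a.rank + 1) ∨ OccursInLayer l q (a.rank - 1) := by
      rw [occursInLayer_iff hl hq, occursInLayer_iff hl hq]
      unfold affineDEdge at hedge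
      omega
    rcases hocc with h | h
    · exact ⟨⟨q, _, h⟩, rfl, Or.inl ((covBy_iff hl _ _).2 ⟨rfl, hcol⟩)⟩
    · exact ⟨⟨q, _, h⟩, rfl, Or.inr ((covBy_iff hl _ _).2 ⟨by simp, hcol.symm⟩)⟩

/-- Two positions which are adjacent to a column and lie strictly between two elements of it. -/
theorem exists_pair (hl : 4 ≤ l) {a b : SpinHeap l} (hcol : a.column = b.column)
    {i j : ℕ} {m n : ℤ} (hne : i ≠ j ∨ m ≠ n) (hi : i + 2 ≤ l) (hj : j + 2 ≤ l)
    (hm : (m - i - 1) % 2 = 0) (hn : (n - j - 1) % 2 = 0)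
    (hall : ∀ (i' : ℕ) (m' : ℤ), i' + 2 ≤ l → (m' - i' - 1) % 2 = 0 →
      ((i' = i ∧ m' = m ∨ i' = j ∧ m' = n) ↔ (a.rank < m' ∧ m' < b.rank) ∧
        (a.column = i' + 1 ∨ i' = a.column + 1))) :
    ∃ x y : SpinHeap l, x ≠ y ∧ ∀ c, (c = x ∨ c = y) ↔
      c ∈ Set.Ioo a b ∧ (a.column = c.column + 1 ∨ c.column = a.column + 1) := by
  obtain ⟨x, hx, hxr⟩ := exists_of_parity hl hi hm
  obtain ⟨y, hy, hyr⟩ := exists_of_parity hl hj hn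
  refine ⟨x, y, ?_, fun c => ?_⟩
  · rintro rfl
    omega
  · have hx' : c = x ↔ c.column = i ∧ c.rank = m :=
      ⟨fun h => by rw [h]; exact ⟨hx, hxr⟩,
        fun h => eq_of_column_eq hl (h.1.trans hx.symm) (h.2.trans hxr.symm)⟩
    have hy' : c = y ↔ c.column = j ∧ c.rank = n :=
      ⟨fun h => by rw [h]; exact ⟨hy, hyr⟩,
        fun h => eq_of_column_eq hl (h.1.trans hy.symm) (h.2.trans hyr.symm)⟩
    rw [hx', hy', hall _ _ (c.column_le hl) (c.rank_parity hl), Set.mem_Ioo,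
      lt_iff_column hl, lt_iff_column hl]
    clear hall hx' hy'
    omega

/-- Consecutive elements with the same label are two or four layers apart. -/
theorem rank_of_consecutive (hl : 4 ≤ l) {a b : SpinHeap l} (hab : a < b)
    (hlab : a.label = b.label) (hcons : ∀ c ∈ Set.Ioo a b, c.label ≠ a.label) :
    b.rank = a.rank + if 2 ≤ (a.label : ℕ) ∧ (a.label : ℕ) + 2 ≤ l then 2 else 4 := by
  have ha := occurs_cases hl a
  have hb := occurs_cases hl b
  have hal := a.label_le
  have hcol : a.column = b.column := by rw [column_eq, column_eq, hlab]
  have hlt := (lt_iff_column hl a b).1 hab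
  rw [← hlab] at hb
  have hgap : ∀ k : ℤ, a.rank < k → k < b.rank → ¬ OccursInLayer l a.label k := by
    intro k h1 h2 h
    have hc : column ⟨a.label, k, h⟩ = a.column := rfl
    refine hcons ⟨a.label, k, h⟩ ⟨(lt_iff_column hl _ _).2 ?_, (lt_iff_column hl _ _).2 ?_⟩ rfl
    · rw [hc]
      exact ⟨h1, by change _ ≤ k - _; omega, by change _ ≤ k - _; omega⟩
    · rw [hc, hcol]
      exact ⟨h2, by change _ ≤ _ - k; omega, by change _ ≤ _ - k; omega⟩
  split_ifs with hmid
  · have hmod : (b.rank - a.rank) % 2 = 0 := by omega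
    have := hgap (a.rank + 2)
    rw [occursInLayer_iff hl hal] at this
    by_contra hne
    exact this (by omega) (by omega) (by omega)
  · have hmod : (b.rank - a.rank) % 4 = 0 := by omega
    clear ha hb
    by_contra hne
    exact hgap (a.rank + 4) (by omega) (by omega) (occursInLayer_add_four_mul 1 a.occurs)

theorem isFullHeap (hl : 4 ≤ l) : IsFullHeap (affineDMatrix l) (label (l := l)) where
  toIsFibredHeap := isFibredHeap hl
  sum_Ioo a b hab hlab hcons := by
    have hb := rank_of_consecutive hl hab hlab hcons
    have hal := a.label_le
    have hca := a.column_le hl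
    have hap := a.rank_parity hl
    have hcol : a.column = b.column := by rw [column_eq, column_eq, hlab]
    have hcolv := column_eq a
    rw [labelColumn] at hcolv
    obtain ⟨x, y, hxy, hset⟩ : ∃ x y : SpinHeap l, x ≠ y ∧ ∀ c, (c = x ∨ c = y) ↔
        c ∈ Set.Ioo a b ∧ (a.column = c.column + 1 ∨ c.column = a.column + 1) := by
      -- An inner label recurs after two layers, enclosing one element of each adjacent column. A
      -- label of an extreme column recurs after four, enclosing two elements of its only adjacent
      -- column.
      by_cases hmid : 2 ≤ (a.label : ℕ) ∧ (a.label : ℕ) + 2 ≤ l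
      · rw [if_pos hmid] at hb
        rw [if_neg (by omega)] at hcolv
        refine exists_pair hl hcol (i := a.column - 1) (j := a.column + 1) (m := a.rank + 1)
          (n := a.rank + 1) (by omega) (by omega) (by omega) (by omega) (by omega) ?_
        intro i' m' hi' hm'
        omega
      · rw [if_neg hmid] at hb
        obtain ⟨i, hi, hia⟩ : ∃ i, i + 2 ≤ l ∧ ∀ i', i' + 2 ≤ l →
            ((a.column = i' + 1 ∨ i' = a.column + 1) ↔ i' = i) := by
          by_cases h0 : a.column = 0
          · exact ⟨1, by omega, fun i' _ => by omega⟩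
          · refine ⟨l - 3, by omega, fun i' _ => ?_⟩
            split_ifs at hcolv <;> omega
        have hai := (hia i hi).2 rfl
        refine exists_pair hl hcol (i := i) (j := i) (m := a.rank + 1) (n := a.rank + 3)
          (by omega) hi hi (by omega) (by omega) ?_
        intro i' m' hi' hm'
        rw [hia i' hi']
        clear hia hcolv hmid
        omega
    have hval : ∀ c, c = x ∨ c = y → affineDMatrix l a.label c.label = -1 := fun c hc => by
      obtain ⟨h1, h2⟩ := (hset c).1 hc
      rw [affineDMatrix_label hl, if_neg fun h => hcons c h1 h.symm, if_pos h2]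
    have hsupp : Set.Ioo a b ∩ Function.support (fun c : SpinHeap l =>
        affineDMatrix l a.label c.label) = ({x, y} : Set (SpinHeap l)) := by
      ext c
      simp only [Set.mem_inter_iff, Function.mem_support, Set.mem_insert_iff,
        Set.mem_singleton_iff]
      rw [hset, affineDMatrix_ne_zero_iff hl]
      refine ⟨fun h => ⟨h.1, h.2.resolve_left fun e => hcons c h.1 e.symm⟩,
        fun h => ⟨h.1, Or.inr h.2⟩⟩
    rw [← finsum_mem_inter_support, hsupp, finsum_mem_pair hxy, hval x (Or.inl rfl),
      hval y (Or.inr rfl)]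
    norm_num

end SpinHeap

/-! ### Proper ideals as lattice paths -/

namespace SpinHeap

variable {l : ℕ}

/-- `m i` is the highest layer in which `I` has an element in column `i`. -/
structure IsProfile (I : Set (SpinHeap l)) (m : ℕ → ℤ) : Prop where
  mem_iff : ∀ a : SpinHeap l, a ∈ I ↔ a.rank ≤ m a.column
  parity : ∀ i, i + 2 ≤ l → (m i - i - 1) % 2 = 0
  step : ∀ i, i + 3 ≤ l → m (i + 1) = m i + 1 ∨ m (i + 1) = m i - 1

theorem IsProfile.abs_sub_le {I : Set (SpinHeap l)} {m : ℕ → ℤ} (h : IsProfile I m) (i d : ℕ)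
    (hd : i + d + 2 ≤ l) : m (i + d) ≤ m i + d ∧ m i ≤ m (i + d) + d := by
  induction d with
  | zero => simp
  | succ d ih =>
    have h1 := ih (by omega)
    have h2 := h.step (i + d) (by omega)
    rw [← add_assoc]
    push_cast
    omega

/-- A column is a chain, so properness at the single label `i + 1` already bounds the ideal there on
both sides. -/
theorem exists_max_in_column (hl : 4 ≤ l) (I : Ideals l) (i : ℕ) (hi : i + 2 ≤ l) :
    ∃ m : ℤ, (m - i - 1) % 2 = 0 ∧
      ∀ a : SpinHeap l, a.column = i → (a ∈ I.carrier ↔ a.rank ≤ m) := by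
  have hcol : labelColumn l (i + 1) = i := by rw [labelColumn, if_neg (by omega)]; omega
  obtain ⟨b, hb, hbI⟩ := I.exists_mem ⟨i + 1, by omega⟩
  obtain ⟨c, hc, hcI⟩ := I.exists_notMem ⟨i + 1, by omega⟩
  have hbc : b.column = i := by rw [column_eq, hb]; exact hcol
  have hcc : c.column = i := by rw [column_eq, hc]; exact hcol
  have hle : ∀ a a' : SpinHeap l, a.column = i → a'.column = i → a.rank ≤ a'.rank → a ≤ a' := by
    intro a a' h h' hr
    rw [le_iff_column hl]
    omega
  obtain ⟨m, ⟨a, haI, hac, har⟩, hmax⟩ := Int.exists_greatest_of_bdd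
    (P := fun k => ∃ a ∈ I.carrier, a.column = i ∧ a.rank = k)
    ⟨c.rank, by
      rintro _ ⟨a, haI, hac, rfl⟩
      by_contra hlt
      exact hcI (I.lower a haI c (hle _ _ hcc hac (by omega)))⟩
    ⟨_, b, hbI, hbc, rfl⟩
  have hap := a.rank_parity hl
  refine ⟨m, by omega, fun d hd => ⟨fun hdI => hmax _ ⟨d, hdI, hd, rfl⟩, fun hdr => ?_⟩⟩
  exact I.lower a haI d (hle _ _ hd hac (by omega))

/-- The position one layer below the top of a column, in the next column, lies under that top. Hence
neighbouring tops differ by at most 1, and parity excludes 0. -/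
theorem exists_isProfile (hl : 4 ≤ l) (I : Ideals l) : ∃ m, IsProfile I.carrier m := by
  choose! m hpar hmem using exists_max_in_column hl I
  refine ⟨m, fun a => hmem _ (a.column_le hl) a rfl, hpar, fun i hi => ?_⟩
  have h1 := hpar i (by omega)
  have h2 := hpar (i + 1) (by omega)
  obtain ⟨a, ha, har⟩ := exists_of_parity hl (show i + 2 ≤ l by omega) h1
  obtain ⟨b, hb, hbr⟩ := exists_of_parity hl (show i + 1 + 2 ≤ l by omega) h2
  have haI := (hmem i (by omega) a ha).2 har.le
  have hbI := (hmem (i + 1) (by omega) b hb).2 hbr.le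
  obtain ⟨c, hc, hcr⟩ := exists_of_parity hl (show i + 1 + 2 ≤ l by omega) (k := m i - 1)
    (by push_cast; omega)
  obtain ⟨d, hd, hdr⟩ := exists_of_parity hl (show i + 2 ≤ l by omega) (k := m (i + 1) - 1)
    (by push_cast at h2; omega)
  have hcI := (hmem (i + 1) (by omega) c hc).1
    (I.lower a haI c ((le_iff_column hl _ _).2 (by omega)))
  have hdI := (hmem i (by omega) d hd).1 (I.lower b hbI d ((le_iff_column hl _ _).2 (by omega)))
  push_cast at h2
  omega

/-- A path with steps ±1 is 1-Lipschitz, which is what closes the region under it downwards in the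
order of `le_iff_column`. -/
theorem exists_ideal (hl : 4 ≤ l) (m : ℕ → ℤ) (hpar : ∀ i, i + 2 ≤ l → (m i - i - 1) % 2 = 0)
    (hstep : ∀ i, i + 3 ≤ l → m (i + 1) = m i + 1 ∨ m (i + 1) = m i - 1) :
    ∃ I : Ideals l, IsProfile I.carrier m := by
  have hprof : IsProfile {a : SpinHeap l | a.rank ≤ m a.column} m := ⟨fun _ => Iff.rfl, hpar, hstep⟩
  refine ⟨⟨{a | a.rank ≤ m a.column}, fun a ha b hba => ?_, fun p => ?_, fun p => ?_⟩, hprof⟩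
  · have hle := (le_iff_column hl _ _).1 hba
    have hca := a.column_le hl
    have hcb := b.column_le hl
    have ha' : a.rank ≤ m a.column := ha
    change b.rank ≤ m b.column
    rcases le_total a.column b.column with h | h
    · have := hprof.abs_sub_le a.column (b.column - a.column) (by omega)
      rw [show a.column + (b.column - a.column) = b.column by omega] at this
      omega
    · have := hprof.abs_sub_le b.column (a.column - b.column) (by omega)
      rw [show b.column + (a.column - b.column) = a.column by omega] at this
      omega
  · obtain ⟨a, rfl, hr⟩ := exists_rank_lt p (m (labelColumn l p))
    exact ⟨a, rfl, hr.le⟩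
  · obtain ⟨a, rfl, hr⟩ := exists_rank_gt p (m (labelColumn l p))
    exact ⟨a, rfl, hr.not_ge⟩

theorem column_zeroElt (hl : 4 ≤ l) (t : ℤ) : (zeroElt l t).column = 0 := by
  rw [column_eq, labelColumn]
  change (if (0 : ℕ) = l then l - 2 else 0 - 1) = 0
  rw [if_neg (by omega)]

theorem IsProfile.height_eq (hl : 4 ≤ l) {I : Set (SpinHeap l)} {m : ℕ → ℤ}
    (h : IsProfile I m) : height I = (m 0 - 1) / 4 := by
  have : {t | zeroElt l t ∈ I} = Set.Iic ((m 0 - 1) / 4) := by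
    ext t
    rw [Set.mem_ofPred_eq, h.mem_iff, column_zeroElt hl]
    change 4 * t + 1 ≤ _ ↔ t ≤ _
    omega
  rw [height, this, csSup_Iic]

theorem phi_zpow_apply (n : ℤ) (a : SpinHeap l) : (phi l ^ n) a = translate n a := by
  have hadd : ∀ (i j : ℤ) (b : SpinHeap l), translate i (translate j b) = translate (i + j) b :=
    fun i j b => SpinHeap.ext rfl (by simp only [translate]; ring)
  induction n using Int.induction_on generalizing a with
  | zero => rw [zpow_zero]; exact SpinHeap.ext rfl (by simp [translate])
  | succ i ih =>
    rw [zpow_add_one, RelIso.mul_apply, ih]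
    exact hadd _ _ _
  | pred i ih =>
    rw [zpow_sub_one, RelIso.mul_apply, ih]
    exact hadd _ (-1) _

theorem IsProfile.image_phi {I : Set (SpinHeap l)} {m : ℕ → ℤ} (h : IsProfile I m) (n : ℤ) :
    IsProfile ((phi l ^ n) '' I) fun i => m i + 4 * n where
  mem_iff a := by
    have : a ∈ (phi l ^ n) '' I ↔ translate (-n) a ∈ I := by
      constructor
      · rintro ⟨b, hb, rfl⟩
        rwa [phi_zpow_apply, translate_translate _ _ (by ring)]
      · intro ha
        exact ⟨_, ha, by rw [phi_zpow_apply, translate_translate _ _ (by ring)]⟩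
    rw [this, h.mem_iff]
    change a.rank + 4 * -n ≤ m a.column ↔ _
    omega
  parity i hi := by
    have := h.parity i hi
    omega
  step i hi := by
    have := h.step i hi
    omega

/-- Rows are layers minus 3 and g adds 1, whence the shift by 2. Below E(0, 0) column i is filled up
to layer 1 - i, so the default -i - 1 is what the formula gives when nothing is left in the column.
-/
theorem IsProfile.gFun_eq (hl : 4 ≤ l) {F : Set (SpinHeap l)} {m : ℕ → ℤ} (h : IsProfile F m)
    (h0 : 1 ≤ m 0) (i : ℕ) (hi : i + 2 ≤ l) :
    gFun (F \ Set.Iic (zeroElt l 0)) i = m i - 2 := by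
  have hmem : ∀ a : SpinHeap l, a ∈ F \ Set.Iic (zeroElt l 0) ↔
      a.rank ≤ m a.column ∧ 1 - (a.column : ℤ) < a.rank := fun a => by
    rw [Set.mem_sdiff, h.mem_iff, Set.mem_Iic, le_iff_column hl, column_zeroElt hl]
    change a.rank ≤ m a.column ∧ ¬ (_ ≤ 4 * 0 + 1 - a.rank ∧ _ ≤ 4 * 0 + 1 - a.rank) ↔ _
    omega
  have hlow : 1 - (i : ℤ) ≤ m i := by
    have := h.abs_sub_le 0 i (by omega)
    rw [zero_add] at this
    omega
  unfold gFun
  split_ifs with hex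
  · have hgr : IsGreatest {y | ∃ a ∈ F \ Set.Iic (zeroElt l 0), a.column = i ∧ a.row = y}
        (m i - 3) := by
      constructor
      · obtain ⟨b, hb, hbi⟩ := hex
        obtain ⟨a, ha, har⟩ := exists_of_parity hl hi (h.parity i hi)
        refine ⟨a, (hmem a).2 ?_, ha, by rw [row, har]⟩
        rw [hmem, hbi] at hb
        rw [ha]
        omega
      · rintro _ ⟨a, ha, rfl, rfl⟩
        rw [hmem] at ha
        rw [row]
        omega
    rw [hgr.csSup_eq]
    ring
  · by_contra hne
    obtain ⟨a, ha, har⟩ := exists_of_parity hl hi (h.parity i hi)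
    refine hex ⟨a, (hmem a).2 ?_, ha⟩
    rw [ha]
    omega

/-! ### Paths and strings -/

/-- The pair `x` encodes the path `m`. -/
structure HasCode (m : ℕ → ℤ) (x : ℤ × SignString l) : Prop where
  -- The first letter is + when label 1 tops column 0 (layer 4t + 3) and - when label 0 does (layer
  -- 4t + 1). Likewise `last` makes the last letter + exactly when label l tops the last column.
  zero : m 0 = 4 * x.1 + 2 + letter x.2 0
  succ : ∀ i, i + 3 ≤ l → m (i + 1) = m i + letter x.2 (i + 1)
  last : (m (l - 2) - l - 2 + letter x.2 (l - 1)) % 4 = 0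

theorem letter_spinString (F : Set (SpinHeap l)) (i : ℕ) (hi : i + 1 < l) :
    letter (spinString F) i = if binaryPath (F \ Set.Iic (zeroElt l 0)) i <
      binaryPath (F \ Set.Iic (zeroElt l 0)) (i + 1) then 1 else -1 := by
  rw [show letter (spinString F) i = spinString F ⟨i, by omega⟩ from letter_val _ ⟨i, by omega⟩]
  simp only [spinString, if_pos hi]
  split_ifs <;> rfl

theorem letter_spinString_last (hl : 4 ≤ l) (F : Set (SpinHeap l)) :
    letter (spinString F) (l - 1) =
      if gFun (F \ Set.Iic (zeroElt l 0)) (l - 2) ≡ (l : ℤ) - 1 [ZMOD 4] then 1 else -1 := by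
  rw [show letter (spinString F) (l - 1) = spinString F ⟨l - 1, by omega⟩ from
    letter_val _ ⟨l - 1, by omega⟩]
  simp only [spinString, if_neg (show ¬ l - 1 + 1 < l by omega)]
  split_ifs <;> rfl

theorem IsProfile.hasCode_code (hl : 4 ≤ l) {I : Ideals l} {m : ℕ → ℤ}
    (h : IsProfile I.carrier m) : HasCode m (code I) := by
  have hh := h.height_eq hl
  set n := height I.carrier with hn
  have hF := h.image_phi (-n)
  have h0 := h.parity 0 (by omega)
  have hg : ∀ i, i + 2 ≤ l →
      gFun ((phi l ^ (-n)) '' I.carrier \ Set.Iic (zeroElt l 0)) i = m i - 4 * n - 2 :=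
    fun i hi => by rw [hF.gFun_eq hl (by push_cast at h0; omega) i hi]; ring
  have hcode : code I = (n, spinString ((phi l ^ (-n)) '' I.carrier)) := rfl
  rw [hcode]
  refine ⟨?_, fun i hi => ?_, ?_⟩
  · have h1 := hg 0 (by omega)
    have e0 : ∀ G : Set (SpinHeap l), binaryPath G 0 = 0 := fun _ => rfl
    have e1 : ∀ G : Set (SpinHeap l), binaryPath G (0 + 1) = gFun G 0 := fun _ => rfl
    rw [letter_spinString _ 0 (by omega), e0, e1, h1]
    push_cast at h0
    split_ifs <;> dsimp only <;> omega
  · have h1 := h.step i hi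
    have e1 : ∀ (G : Set (SpinHeap l)) i, binaryPath G (i + 1) = gFun G i := fun _ _ => rfl
    rw [letter_spinString _ (i + 1) (by omega), e1, e1, hg i (by omega), hg (i + 1) (by omega)]
    split_ifs <;> omega
  · have h1 := h.parity (l - 2) (by omega)
    rw [letter_spinString_last hl, hg (l - 2) (by omega)]
    simp only [Int.ModEq]
    split_ifs <;> omega

theorem HasCode.unique (hl : 4 ≤ l) {m : ℕ → ℤ} {x y : ℤ × SignString l} (hx : HasCode m x)
    (hy : HasCode m y) : x = y := by
  have h0 := hx.zero
  have h0' := hy.zero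
  have c := letter_eq x.2 (show 0 < l by omega)
  have c' := letter_eq y.2 (show 0 < l by omega)
  refine Prod.ext (by omega) (letter_injective (funext fun i => ?_))
  rcases Nat.lt_or_ge i l with hi | hi
  · rcases Nat.eq_zero_or_pos i with rfl | hpos
    · omega
    · obtain ⟨j, rfl⟩ : ∃ j, i = j + 1 := ⟨i - 1, by omega⟩
      rcases Nat.lt_or_ge (j + 2) l with hj | hj
      · have := hx.succ j (by omega)
        have := hy.succ j (by omega)
        omega
      · have e : j + 1 = l - 1 := by omega
        have h1 := hx.last
        have h2 := hy.last
        rw [← e] at h1 h2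
        have := letter_eq x.2 hi
        have := letter_eq y.2 hi
        omega
  · simp [letter, hi.not_gt]

theorem HasCode.path_unique {m m' : ℕ → ℤ} {x : ℤ × SignString l}
    (h : HasCode m x) (h' : HasCode m' x) (i : ℕ) (hi : i + 2 ≤ l) : m i = m' i := by
  induction i with
  | zero => rw [h.zero, h'.zero]
  | succ i ih => rw [h.succ i (by omega), h'.succ i (by omega), ih (by omega)]

theorem HasCode.sum_eq {m : ℕ → ℤ} {x : ℤ × SignString l} (h : HasCode m x) (i : ℕ)
    (hi : i + 2 ≤ l) : m i = 4 * x.1 + 2 + ∑ j ∈ Finset.range (i + 1), letter x.2 j := by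
  induction i with
  | zero => simpa using h.zero
  | succ i ih => rw [h.succ i (by omega), ih (by omega), Finset.sum_range_succ _ (i + 1)]; ring

/-- The sum of the letters is l minus twice the number of minus signs. -/
theorem evenMinus_iff_sum (s : SignString l) :
    EvenMinus s ↔ ((∑ j ∈ Finset.range l, letter s j) - l) % 4 = 0 := by
  have h1 : ∑ j ∈ Finset.range l, letter s j = ∑ i : Fin l, (1 - 2 * if s i = -1 then 1 else 0) := by
    rw [Finset.sum_range]
    refine Finset.sum_congr rfl fun i _ => ?_
    rw [letter_val]
    rcases Int.units_eq_one_or (s i) with e | e <;> simp [e]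
  rw [h1, Finset.sum_sub_distrib, ← Finset.mul_sum, Finset.sum_boole, EvenMinus]
  simp only [Finset.sum_const, Finset.card_univ, Fintype.card_fin, nsmul_eq_mul, mul_one]
  rw [Nat.even_iff]
  omega

/-- The path ends at 4t + 2 plus the sum of the first l - 1 letters, so the congruence for the last
letter says that the sum of all letters is l modulo 4. -/
theorem HasCode.evenMinus (hl : 4 ≤ l) {m : ℕ → ℤ} {x : ℤ × SignString l} (h : HasCode m x) :
    EvenMinus x.2 := by
  obtain ⟨k, rfl⟩ : ∃ k, l = k + 2 := ⟨l - 2, by omega⟩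
  have h1 := h.sum_eq k le_rfl
  have h2 := h.last
  rw [evenMinus_iff_sum, Finset.sum_range_succ]
  simp only [Nat.add_sub_cancel, show k + 2 - 1 = k + 1 by omega] at h2
  omega

theorem exists_ideal_of_evenMinus (hl : 4 ≤ l) (x : ℤ × SignString l) (hx : EvenMinus x.2) :
    ∃ I : Ideals l, code I = x := by
  set m : ℕ → ℤ := fun i => 4 * x.1 + 2 + ∑ j ∈ Finset.range (i + 1), letter x.2 j with hm
  have hsucc : ∀ i, m (i + 1) = m i + letter x.2 (i + 1) := fun i => by
    simp only [hm, Finset.sum_range_succ _ (i + 1)]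
    ring
  have hzero : m 0 = 4 * x.1 + 2 + letter x.2 0 := by simp [hm]
  have hcode : HasCode m x := by
    refine ⟨hzero, fun i _ => hsucc i, ?_⟩
    rw [evenMinus_iff_sum] at hx
    obtain ⟨k, rfl⟩ : ∃ k, l = k + 2 := ⟨l - 2, by omega⟩
    rw [Finset.sum_range_succ] at hx
    simp only [Nat.add_sub_cancel, show k + 2 - 1 = k + 1 by omega, hm]
    omega
  obtain ⟨I, hI⟩ := exists_ideal hl m (fun i hi => by
    induction i with
    | zero =>
      have := letter_eq x.2 (show 0 < l by omega)
      push_cast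
      omega
    | succ i ih =>
      have := letter_eq x.2 (show i + 1 < l by omega)
      have := ih (by omega)
      rw [hsucc]
      push_cast
      omega) (fun i hi => by
    have := letter_eq x.2 (show i + 1 < l by omega)
    rw [hsucc]
    omega)
  exact ⟨I, (hI.hasCode_code hl).unique hl hcode⟩

theorem code_injective (hl : 4 ≤ l) : Function.Injective (code (l := l)) := fun I J h => by
  obtain ⟨m, hm⟩ := exists_isProfile hl I
  obtain ⟨m', hm'⟩ := exists_isProfile hl J
  have h1 := hm.hasCode_code hl
  have h2 := hm'.hasCode_code hl
  rw [h] at h1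
  refine ProperIdeal.ext (Set.ext fun a => ?_)
  rw [hm.mem_iff, hm'.mem_iff, h1.path_unique h2 _ (a.column_le hl)]

theorem evenMinus_code (hl : 4 ≤ l) (I : Ideals l) : EvenMinus (code I).2 := by
  obtain ⟨m, hm⟩ := exists_isProfile hl I
  exact (hm.hasCode_code hl).evenMinus hl

theorem bijOn_code (hl : 4 ≤ l) :
    Set.BijOn (code (l := l)) Set.univ {x | EvenMinus x.2} :=
  ⟨fun I _ => evenMinus_code hl I, (code_injective hl).injOn, fun x hx =>
    (exists_ideal_of_evenMinus hl x hx).imp fun _ h => ⟨Set.mem_univ _, h⟩⟩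

end SpinHeap

/-! ### The reflections of ideals and of strings -/

namespace SpinHeap

variable {l : ℕ}

/-- Removing the element of layer `m i` in the column `i` of the label `p` from the path `m`. -/
def lowerPath (l p : ℕ) (m : ℕ → ℤ) (i : ℕ) : ℤ := if i = labelColumn l p then m i - 2 else m i

/-- Subtracting twice the root lowers the path by 2 in the column of p and nowhere else. For p = 0
the integer contributes -4 and the first letter +2. In the last column, the change of the last
letter keeps the final congruence. -/
theorem HasCode.lowerPath (hl : 4 ≤ l) {m : ℕ → ℤ} {x : ℤ × SignString l} (h : HasCode m x)
    (hpar : ∀ i, i + 2 ≤ l → (m i - i - 1) % 2 = 0) (p : Fin (l + 1)) (hx : affineDCoroot l p (affineWeight x) = 2) :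
    HasCode (lowerPath l p m) (simpleAct hl p x) ∧ OccursInLayer l p (m (labelColumn l p)) := by
  obtain ⟨p, hp⟩ := p
  have hp' : p ≤ l := by omega
  have hw := affineWeight_simpleAct hl ⟨p, hp⟩ x
  rw [reflectionMap_apply, hx] at hw
  have hz := h.zero
  have hlast := h.last
  rw [occursInLayer_iff hl hp']
  obtain ⟨t, s⟩ := x
  set y := simpleAct hl ⟨p, hp⟩ (t, s) with hy
  have hy1 : 2 * y.1 = (affineWeight (t, s) - (2 : ℤ) • affineDRoot l p).2 := congrArg Prod.snd hw
  have hy2 : ∀ i, letter y.2 i = (affineWeight (t, s) - (2 : ℤ) • affineDRoot l p).1 i :=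
    fun i => congrFun (congrArg Prod.fst hw) i
  clear_value y
  have hc := fun i hi => letter_eq s (i := i) hi
  simp only at hx hz hlast
  simp only [affineDCoroot] at hx
  simp only [affineWeight, Prod.fst_sub, Prod.snd_sub, Prod.smul_fst, Prod.smul_snd, Pi.sub_apply,
    Pi.smul_apply, smul_eq_mul, affineDRoot] at hy1 hy2
  obtain hp0 | ⟨hp0, hpl⟩ | hpl : p = 0 ∨ (0 < p ∧ p < l) ∨ p = l := by omega
  · have hcol : labelColumn l p = 0 := by rw [labelColumn, if_neg (by omega)]; omega
    simp only [if_pos hp0, Pi.sub_apply, Pi.neg_apply, Pi.single_apply] at hy1 hy2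
    simp only [if_pos hp0, LinearMap.sub_apply, LinearMap.neg_apply, linearCoord_apply,
      affineWeight] at hx
    have c0 := hc 0 (by omega)
    have c1 := hc 1 (by omega)
    refine ⟨⟨?_, fun i hi => ?_, ?_⟩, ?_⟩
    · rw [SpinHeap.lowerPath, hcol, if_pos rfl, hy2, if_pos rfl, if_neg (by omega)]
      omega
    · have h1 := h.succ i hi
      simp only at h1
      simp only [SpinHeap.lowerPath, hcol, hy2]
      rcases Nat.eq_zero_or_pos i with rfl | hi0
      · simp only [zero_add] at *
        simp
        omega
      · rw [if_neg (by omega), if_neg (by omega), if_neg (by omega), if_neg (by omega)]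
        omega
    · rw [SpinHeap.lowerPath, hcol, if_neg (by omega), hy2, if_neg (by omega), if_neg (by omega)]
      omega
    · rw [hcol]
      omega
  · have hcol : labelColumn l p = p - 1 := by rw [labelColumn, if_neg (by omega)]
    simp only [if_neg hp0.ne', if_pos hpl, Pi.sub_apply, Pi.single_apply] at hy1 hy2
    simp only [if_neg hp0.ne', if_pos hpl, LinearMap.sub_apply, linearCoord_apply,
      affineWeight] at hx
    have c0 := hc (p - 1) (by omega)
    have c1 := hc p (by omega)
    refine ⟨⟨?_, fun i hi => ?_, ?_⟩, ?_⟩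
    · simp only [SpinHeap.lowerPath, hcol, hy2]
      split_ifs <;> omega
    · have h1 := h.succ i hi
      simp only at h1
      simp only [SpinHeap.lowerPath, hcol, hy2]
      split_ifs <;> omega
    · simp only [SpinHeap.lowerPath, hcol, hy2]
      split_ifs <;> omega
    · have h1 := hpar (p - 1) (by omega)
      rw [hcol]
      refine ⟨by omega, fun e => ?_, fun e => ?_, by omega, by omega⟩
      · rw [show p - 1 = 0 by omega] at hx c0 ⊢
        omega
      · rw [show p = l - 1 by omega] at hx c0 c1 ⊢
        rw [show l - 1 - 1 = l - 2 by omega] at *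
        omega
  · have hcol : labelColumn l p = l - 2 := by rw [labelColumn, if_pos hpl]
    simp only [if_neg (show p ≠ 0 by omega), if_neg (show ¬ p < l by omega), Pi.add_apply,
      Pi.single_apply] at hy1 hy2
    simp only [if_neg (show p ≠ 0 by omega), if_neg (show ¬ p < l by omega), LinearMap.add_apply,
      linearCoord_apply, affineWeight] at hx
    have c0 := hc (l - 2) (by omega)
    have c1 := hc (l - 1) (by omega)
    refine ⟨⟨?_, fun i hi => ?_, ?_⟩, ?_⟩
    · simp only [SpinHeap.lowerPath, hcol, hy2]
      split_ifs <;> omega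
    · have h1 := h.succ i hi
      simp only at h1
      simp only [SpinHeap.lowerPath, hcol, hy2]
      split_ifs <;> omega
    · simp only [SpinHeap.lowerPath, hcol, hy2]
      split_ifs <;> omega
    · rw [hcol]
      omega

/-- A removable element is maximal in I, hence a local maximum of the path, which fixes the steps on
both sides. At an extreme column the missing step is replaced by the first or last letter, which the
label determines. -/
theorem Removes.coroot_eq_two (hl : 4 ≤ l) {I J : Ideals l} {p : Fin (l + 1)}
    (h : I.Removes p J) : affineDCoroot l p (affineWeight (code I)) = 2 := by
  obtain ⟨a, haI, rfl, hJ⟩ := h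
  obtain ⟨m, hm⟩ := exists_isProfile hl I
  have hcode := hm.hasCode_code hl
  have hmax : ∀ b ∈ I.carrier, a ≤ b → b = a := by
    intro b hb hab
    by_contra hne
    have hbJ : b ∈ J.carrier := by rw [hJ]; exact ⟨hb, hne⟩
    have := J.lower b hbJ a hab
    rw [hJ] at this
    exact this.2 rfl
  have hca := a.column_le hl
  have har : a.rank = m a.column := by
    obtain ⟨b, hb, hbr⟩ := exists_of_parity hl hca (hm.parity _ hca)
    have hbI : b ∈ I.carrier := by rw [hm.mem_iff, hb, hbr]
    have hle := (hm.mem_iff a).1 haI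
    rw [← hmax b hbI ((le_iff_column hl _ _).2 (by omega)), hbr, hb]
  have hnbr : ∀ i, i + 2 ≤ l → (a.column = i + 1 ∨ i = a.column + 1) →
      m i ≠ m a.column + 1 := by
    intro i hi hai e
    obtain ⟨b, hb, hbr⟩ := exists_of_parity hl hi (hm.parity _ hi)
    have hbI : b ∈ I.carrier := by rw [hm.mem_iff, hb, hbr]
    have := hmax b hbI ((le_iff_column hl _ _).2 (by omega))
    rw [this] at hb
    omega
  have hocc := occurs_cases hl a
  have hal := a.label_le
  rw [har] at hocc
  have hcol := column_eq a
  rw [labelColumn] at hcol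
  have hz := hcode.zero
  have hlast := hcode.last
  have hc := fun i hi => letter_eq (code I).2 (i := i) hi
  simp only [affineDCoroot]
  split_ifs with h0 h1
  · rw [if_neg (by omega), h0] at hcol
    simp only [LinearMap.sub_apply, LinearMap.neg_apply, linearCoord_apply, affineWeight]
    have h2 := hnbr 1 (by omega) (by omega)
    have h3 := hcode.succ 0 (by omega)
    have c0 := hc 0 (by omega)
    have c1 := hc 1 (by omega)
    rw [hcol] at hocc h2
    simp only [zero_add, Nat.zero_sub] at *
    omega
  · rw [if_neg (by omega)] at hcol
    simp only [LinearMap.sub_apply, linearCoord_apply, affineWeight]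
    have c0 := hc (a.label - 1) (by omega)
    have c1 := hc a.label (by omega)
    have hleft : letter (code I).2 (a.label - 1) = 1 := by
      rcases Nat.eq_zero_or_pos a.column with e | e
      · rw [e] at hocc
        rw [← hcol, e] at c0 ⊢
        omega
      · have h2 := hnbr (a.column - 1) (by omega) (by omega)
        have h3 := hcode.succ (a.column - 1) (by omega)
        rw [show a.column - 1 + 1 = a.column by omega] at h3
        rw [← hcol] at c0 ⊢
        omega
    have hright : letter (code I).2 a.label = -1 := by
      rcases Nat.lt_or_ge (a.label + 1) l with e | e
      · have h2 := hnbr (a.column + 1) (by omega) (by omega)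
        have h3 := hcode.succ a.column (by omega)
        rw [show a.column + 1 = a.label by omega] at h2 h3
        omega
      · have e1 : a.column = l - 2 := by omega
        rw [show (a.label : ℕ) = l - 1 by omega] at c1 ⊢
        rw [e1] at hocc
        omega
    omega
  · rw [if_pos (by omega)] at hcol
    simp only [LinearMap.add_apply, linearCoord_apply, affineWeight]
    have c0 := hc (l - 2) (by omega)
    have c1 := hc (l - 1) (by omega)
    have h2 := hnbr (l - 3) (by omega) (by omega)
    have h3 := hcode.succ (l - 3) (by omega)
    rw [show l - 3 + 1 = l - 2 by omega] at h3
    rw [hcol] at hocc h2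
    omega

theorem removes_of_coroot_eq_two (hl : 4 ≤ l) {I J : Ideals l} {p : Fin (l + 1)}
    (hx : affineDCoroot l p (affineWeight (code I)) = 2)
    (hJ : code J = simpleAct hl p (code I)) : I.Removes p J := by
  obtain ⟨m, hm⟩ := exists_isProfile hl I
  obtain ⟨m', hm'⟩ := exists_isProfile hl J
  obtain ⟨h1, hocc⟩ := (hm.hasCode_code hl).lowerPath hl hm.parity p hx
  have h2 := hm'.hasCode_code hl
  rw [hJ] at h2
  obtain ⟨a, hap, hac, har⟩ := exists_of_occurs (p : ℕ) (by omega) _ hocc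
  refine ⟨a, by rw [hm.mem_iff, hac, har], Fin.ext hap, Set.ext fun b => ?_⟩
  have hb := b.column_le hl
  have hbp := b.rank_parity hl
  have hmp := hm.parity _ hb
  rw [Set.mem_sdiff, Set.mem_singleton_iff, hm'.mem_iff, hm.mem_iff, h2.path_unique h1 _ hb,
    SpinHeap.lowerPath]
  have hba : b = a ↔ b.column = a.column ∧ b.rank = a.rank :=
    ⟨fun e => by rw [e]; exact ⟨rfl, rfl⟩, fun e => eq_of_column_eq hl e.1 e.2⟩
  rw [hba, hac, har]
  split_ifs with e
  · rw [← e]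
    omega
  · omega

/-- Elements labelled p form a chain, and only a maximal element of I can be removed. -/
theorem Removes.unique (hl : 4 ≤ l) {I J K : Ideals l} {p : Fin (l + 1)}
    (hJ : I.Removes p J) (hK : I.Removes p K) : J = K := by
  obtain ⟨a, ha, rfl, hJ⟩ := hJ
  obtain ⟨b, hb, hab, hK⟩ := hK
  have key : ∀ (L : Ideals l) (c d : SpinHeap l), d ∈ I.carrier →
      L.carrier = I.carrier \ {c} → c ≤ d → c = d := by
    intro L c d hd hL hcd
    by_contra hne
    have := L.lower d (by rw [hL]; exact ⟨hd, fun e => hne e.symm⟩) c hcd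
    rw [hL] at this
    exact this.2 rfl
  have : a = b := by
    rcases (isHeap hl).comparable a b (by rw [hab]; simp [affineDMatrix]) with h | h
    · exact key J a b hb hJ h
    · exact (key K b a ha hK h).symm
  subst this
  exact ProperIdeal.ext (hJ.trans hK.symm)

/-- The ideal with the predicted code also arises by removing an element labelled p, so uniqueness
of the removal identifies it with J. -/
theorem Removes.code_eq (hl : 4 ≤ l) {I J : Ideals l} {p : Fin (l + 1)} (h : I.Removes p J) :
    code J = simpleAct hl p (code I) := by
  obtain ⟨K, hK⟩ := exists_ideal_of_evenMinus hl (simpleAct hl p (code I))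
    ((evenMinus_simpleAct hl p _).2 (evenMinus_code hl I))
  rw [Removes.unique hl h (removes_of_coroot_eq_two hl (Removes.coroot_eq_two hl h) hK), hK]

theorem adds_iff_removes {p : Fin (l + 1)} {I J : Ideals l} : I.Adds p J ↔ J.Removes p I := by
  refine exists_congr fun a => ⟨?_, ?_⟩
  · rintro ⟨ha, hp, hJ⟩
    refine ⟨by simp [hJ], hp, ?_⟩
    rw [hJ]
    ext b
    simp only [Set.mem_sdiff, Set.mem_union, Set.mem_singleton_iff]
    exact ⟨fun hb => ⟨Or.inl hb, fun e => ha (e ▸ hb)⟩, fun hb => hb.1.resolve_right hb.2⟩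
  · rintro ⟨ha, hp, hI⟩
    refine ⟨by simp [hI], hp, ?_⟩
    rw [hI]
    ext b
    simp only [Set.mem_sdiff, Set.mem_union, Set.mem_singleton_iff]
    refine ⟨fun hb => ?_, fun hb => hb.elim (fun h => h.1) fun e => e ▸ ha⟩
    by_cases e : b = a
    · exact Or.inr e
    · exact Or.inl ⟨hb, e⟩

theorem coroot_affineWeight_cases (hl : 4 ≤ l) (p : Fin (l + 1)) (x : ℤ × SignString l) :
    affineDCoroot l p (affineWeight x) = 2 ∨ affineDCoroot l p (affineWeight x) = -2 ∨
      affineDCoroot l p (affineWeight x) = 0 := by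
  have hc := fun i hi => letter_eq x.2 (i := i) hi
  simp only [affineDCoroot]
  split_ifs with h0 h1
  · have c0 := hc 0 (by omega)
    have c1 := hc 1 (by omega)
    simp only [LinearMap.sub_apply, LinearMap.neg_apply, linearCoord_apply, affineWeight]
    omega
  · have c0 := hc (p - 1) (by omega)
    have c1 := hc p (by omega)
    simp only [LinearMap.sub_apply, linearCoord_apply, affineWeight]
    omega
  · have c0 := hc (l - 2) (by omega)
    have c1 := hc (l - 1) (by omega)
    simp only [LinearMap.add_apply, linearCoord_apply, affineWeight]
    omega

/-- The bijection `code` intertwines the operators `S_p` with the generators on strings. -/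
theorem code_reflect (hl : 4 ≤ l) (p : Fin (l + 1)) (I : Ideals l) :
    code (I.reflect p) = simpleAct hl p (code I) := by
  unfold ProperIdeal.reflect
  split_ifs with hR hA
  · exact Removes.code_eq hl hR.choose_spec
  · rw [Removes.code_eq hl (adds_iff_removes.1 hA.choose_spec), simpleAct_involutive hl p]
  · obtain ⟨K, hK⟩ := exists_ideal_of_evenMinus hl (simpleAct hl p (code I))
      ((evenMinus_simpleAct hl p _).2 (evenMinus_code hl I))
    -- Coroot 2 would permit a removal. Coroot -2 becomes 2 after reflecting, which would permit an
    -- addition. Only 0 remains, and there the generator fixes the code.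
    rcases coroot_affineWeight_cases hl p (code I) with h | h | h
    · exact absurd ⟨K, removes_of_coroot_eq_two hl h hK⟩ hR
    · refine absurd ⟨K, adds_iff_removes.2 (removes_of_coroot_eq_two hl ?_ ?_)⟩ hA
      · rw [hK, affineWeight_simpleAct, reflectionMap_apply, map_sub, map_smul, h,
          (affineD_realization hl).apply_root p p, (affineD_realization hl).diag]
        norm_num
      · rw [hK, simpleAct_involutive hl p]
    · apply affineWeight_injective
      rw [affineWeight_simpleAct, reflectionMap_apply, h, zero_smul, sub_zero]

/-- Proper ideals and pairs of an integer and an even string. -/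
noncomputable def codeEquiv (hl : 4 ≤ l) :
    Ideals l ≃ {x : ℤ × SignString l // EvenMinus x.2} :=
  Equiv.ofBijective (fun I => ⟨code I, evenMinus_code hl I⟩)
    ⟨fun _ _ h => code_injective hl (Subtype.ext_iff.1 h), fun x =>
      (exists_ideal_of_evenMinus hl x.1 x.2).imp fun _ h => Subtype.ext h⟩

theorem codeEquiv_apply (hl : 4 ≤ l) (I : Ideals l) : (codeEquiv hl I : ℤ × SignString l) = code I :=
  rfl

theorem code_codeEquiv_symm (hl : 4 ≤ l) (x : {x : ℤ × SignString l // EvenMinus x.2}) :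
    code ((codeEquiv hl).symm x) = x := by
  rw [← codeEquiv_apply hl, Equiv.apply_symm_apply]

/-- The action of the Weyl group on proper ideals. -/
noncomputable def idealAction (hl : 4 ≤ l) :
    WeylGroup (affineDMatrix l) →* Equiv.Perm (Ideals l) :=
  MonoidHom.toHomPerm
    { toFun := fun w I => (codeEquiv hl).symm
        ⟨stringAction hl w (code I), (evenMinus_stringAction hl w _).2 (evenMinus_code hl I)⟩
      map_one' := by
        funext I
        apply code_injective hl
        simp only [code_codeEquiv_symm, map_one]
        rfl
      map_mul' := fun w w' => by
        funext I
        apply code_injective hl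
        change code ((codeEquiv hl).symm _) = code ((codeEquiv hl).symm _)
        simp only [code_codeEquiv_symm, map_mul, Equiv.Perm.mul_apply] }

theorem code_idealAction (hl : 4 ≤ l) (w : WeylGroup (affineDMatrix l)) (I : Ideals l) :
    code (idealAction hl w I) = stringAction hl w (code I) :=
  code_codeEquiv_symm hl _

theorem idealAction_simple (hl : 4 ≤ l) (p : Fin (l + 1)) (I : Ideals l) :
    idealAction hl (weylSimple (affineDMatrix l) p) I = I.reflect p := by
  apply code_injective hl
  rw [code_idealAction, stringAction_simple, code_reflect hl]

end SpinHeap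

/-! ### The generators on letters, and the proposition -/

theorem simpleAct_succ {l : ℕ} (hl : 4 ≤ l) {i j : Fin l} (hij : (j : ℕ) = i + 1)
    (x : ℤ × SignString l) : simpleAct hl i.succ x = (x.1, exchange i j x.2) := by
  have hi : (⟨(i.succ : ℕ) - 1, by simp⟩ : Fin l) = i := Fin.ext (by simp)
  have hj : (⟨i.succ, by simp [← hij]⟩ : Fin l) = j := Fin.ext (by simp [hij])
  rw [simpleAct, if_neg (by simp), dif_pos (by simp [← hij]), hi, hj]

theorem simpleAct_last {l : ℕ} (hl : 4 ≤ l) {i j : Fin l} (hi : (i : ℕ) + 2 = l)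
    (hj : (j : ℕ) + 1 = l) (x : ℤ × SignString l) :
    simpleAct hl j.succ x = (x.1, alter i j (exchange i j x.2)) := by
  have hi' : (⟨l - 2, by omega⟩ : Fin l) = i := Fin.ext (by simp; omega)
  have hj' : (⟨l - 1, by omega⟩ : Fin l) = j := Fin.ext (by simp; omega)
  rw [simpleAct, if_neg (by simp), dif_neg (by simp [hj]), hi', hj']

theorem simpleAct_zero {l : ℕ} (hl : 4 ≤ l) {i j : Fin l} (hi : (i : ℕ) = 0)
    (hj : (j : ℕ) = 1) (x : ℤ × SignString l) :
    simpleAct hl 0 x = if x.2 i = x.2 j then (x.1 + (x.2 i : ℤ), alter i j x.2) else x := by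
  have hi' : (⟨0, by omega⟩ : Fin l) = i := Fin.ext hi.symm
  have hj' : (⟨1, by omega⟩ : Fin l) = j := Fin.ext hj.symm
  rw [simpleAct, if_pos (by simp), hi', hj']

theorem proposition8p2 (l : ℕ) (hl : 4 ≤ l) :
    -- `SpinHeap l` is a full heap of type `D_l^{(1)}`, ranked by its layers
    IsFullHeap (affineDMatrix l) (SpinHeap.label (l := l)) ∧
    (∀ a b : SpinHeap l, a ⋖ b → b.rank = a.rank + 1) ∧
    -- the subgroup `W₀` is finite, and is the Weyl group of type `D_l`
    Finite (finiteWeylSubgroup l) ∧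
    (∃ e : WeylGroup (CartanMatrix.D l) ≃* finiteWeylSubgroup l,
      ∀ i : Fin l, e (weylSimple (CartanMatrix.D l) i) = finiteSimple l i) ∧
    -- the identification of proper ideals with pairs of an integer and an even string
    Set.BijOn (SpinHeap.code (l := l)) Set.univ {x | EvenMinus x.2} ∧
    -- the action of `W` on proper ideals
    ∃ ρ : WeylGroup (affineDMatrix l) →* Equiv.Perm (SpinHeap.Ideals l),
      (∀ (p : Fin (l + 1)) (I : SpinHeap.Ideals l),
        ρ (weylSimple (affineDMatrix l) p) I = I.reflect p) ∧
      -- the induced action of `W₀` on even strings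
      ∃ τ : finiteWeylSubgroup l →* Equiv.Perm (EvenString l),
        (∀ (w : finiteWeylSubgroup l) (I : SpinHeap.Ideals l) (u : EvenString l),
          (SpinHeap.code I).2 = u →
            SpinHeap.code (ρ w I) = ((SpinHeap.code I).1, (τ w u : SignString l))) ∧
        (∀ u v : EvenString l, ∃ w : finiteWeylSubgroup l, τ w u = v) ∧
        Function.Injective τ ∧
        (∀ i j : Fin l, (j : ℕ) = i + 1 → ∀ u : EvenString l,
          (τ (finiteSimple l i) u : SignString l) = exchange i j u) ∧
        (∀ i j : Fin l, (i : ℕ) + 2 = l → (j : ℕ) + 1 = l → ∀ u : EvenString l,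
          (τ (finiteSimple l j) u : SignString l) = alter i j (exchange i j u)) ∧
        -- the extension to an action of `W` on `ℤ × {+, -}^l`
        ∃ σ : WeylGroup (affineDMatrix l) →* Equiv.Perm (ℤ × SignString l),
          (∀ (w : WeylGroup (affineDMatrix l)) (I : SpinHeap.Ideals l),
            SpinHeap.code (ρ w I) = σ w (SpinHeap.code I)) ∧
          (∀ (w : finiteWeylSubgroup l) (t : ℤ) (u : EvenString l),
            σ w (t, u) = (t, (τ w u : SignString l))) ∧
          Function.Injective σ ∧
          (∀ w : WeylGroup (affineDMatrix l),
            (∀ (t : ℤ) (u : EvenString l), σ w (t, u) = (t, (u : SignString l))) → w = 1) ∧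
          (∀ i j : Fin l, (j : ℕ) = i + 1 → ∀ (t : ℤ) (s : SignString l),
            σ (weylSimple (affineDMatrix l) i.succ) (t, s) = (t, exchange i j s)) ∧
          (∀ i j : Fin l, (i : ℕ) + 2 = l → (j : ℕ) + 1 = l → ∀ (t : ℤ) (s : SignString l),
            σ (weylSimple (affineDMatrix l) j.succ) (t, s) =
              (t, alter i j (exchange i j s))) ∧
          (∀ i j : Fin l, (i : ℕ) = 0 → (j : ℕ) = 1 → ∀ (t : ℤ) (s : SignString l),
            (s i = 1 → s j = 1 →
              σ (weylSimple (affineDMatrix l) 0) (t, s) = (t + 1, alter i j s)) ∧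
            (s i = -1 → s j = -1 →
              σ (weylSimple (affineDMatrix l) 0) (t, s) = (t - 1, alter i j s)) ∧
            (s i = 1 → s j = -1 →
              σ (weylSimple (affineDMatrix l) 0) (t, s) = (t, s)) ∧
            (s i = -1 → s j = 1 →
              σ (weylSimple (affineDMatrix l) 0) (t, s) = (t, s))) := by
  refine ⟨SpinHeap.isFullHeap hl, fun a b h => ((SpinHeap.covBy_iff hl a b).1 h).1,
    finite_finiteWeylSubgroup hl, exists_weylGroupD_equiv hl, SpinHeap.bijOn_code hl,
    SpinHeap.idealAction hl, SpinHeap.idealAction_simple hl, finiteAction hl, ?_,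
    finiteAction_transitive hl, finiteAction_injective hl, ?_, ?_, stringAction hl,
    SpinHeap.code_idealAction hl, stringAction_eq_finiteAction hl, ?_,
    eq_one_of_stringAction_eq hl, ?_, ?_, ?_⟩
  · intro w I u hu
    rw [SpinHeap.code_idealAction, ← stringAction_eq_finiteAction, ← hu]
  · intro i j hij u
    rw [finiteAction_simple, simpleAct_succ hl hij]
  · intro i j hi hj u
    rw [finiteAction_simple, simpleAct_last hl hi hj]
  -- Faithfulness on all pairs follows from faithfulness on those with an even string.
  · rw [injective_iff_map_eq_one]
    intro w hw
    exact eq_one_of_stringAction_eq hl w fun t u => by rw [hw]; rfl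
  · intro i j hij t s
    rw [stringAction_simple, simpleAct_succ hl hij]
  · intro i j hi hj t s
    rw [stringAction_simple, simpleAct_last hl hi hj]
  · intro i j hi hj t s
    rw [stringAction_simple, simpleAct_zero hl hi hj]
    refine ⟨fun h1 h2 => ?_, fun h1 h2 => ?_, fun h1 h2 => ?_, fun h1 h2 => ?_⟩
    · simp [h1, h2]
    · simp [h1, h2, sub_eq_add_neg]
    · exact if_neg (by simp only [h1, h2]; decide)
    · exact if_neg (by simp only [h1, h2]; decide)
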